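/- Let $L\ge 2$ be even and consider the $L\times L$ hexagonal lattice on a torus: a brick wall with $L$ rows of $L$ hexagons, consecutive rows shifted by half a hexagon, with opposite sides of the rectangle identified ($2L^2$ vertices, $3L^2$ edges, $L^2$ faces). Its toric code has one qubit per edge; the stabiliser group $S$ is generated by $Z(\partial f)$ for faces $f$ and $X(\delta v)$ for vertices $v$, and $N(S)$ is the normaliser of $S$ in the Pauli group (operators are taken up to global phase). The weight of a Pauli operator is the number of qubits on which it is not the identity. For a class in $H_1$ or $H^1$ (coefficients in $\mathbb Z_2$), let $d$ be the least number of edges in a cycle, respectively cocycle, of that class. Then $H_1\cong H^1\cong\mathbb Z_2^2$, the code encodes two qubits, and the logical operators can be chosen so that $\bar Z_1,\bar Z_2$ are given by the horizontal and the vertical loop of the lattice, whose classes form a basis of $H_1$, and $\bar X_1,\bar X_2$ by the vertical and the horizontal loop of the dual lattice, whose classes form a basis of $H^1$. The minimal weights are $$d(\bar Z_1)=d(\bar Z_2)=2L,\quad d(\bar Z_1\bar Z_2)=3L,\quad d(\bar X_1)=d(\bar X_2)=L,\quad d(\bar X_1\bar X_2)=\tfrac32L .$$ Let $\bar M=\{I,\bar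 X_1,\bar X_2\}$ be the admissible logical errors (single logical bit flips), and let $M\subset N(S)$ be the set of physical operators that represent an element of $\bar M$. Then accepting $\bar M$ raises the distance from $L$ to $\tfrac32L$: the least weight of an element of $N(S)\setminus S$ is $L$, and the least weight of an element of $N(S)\setminus M$ is $\tfrac32L$. Moreover, with $w=\lfloor\tfrac34L-\tfrac12\rfloor$: 1. The Pauli errors of weight at most $w$ satisfy the error transmuting conditions for $\bar M$: there is a map $\pi$ from these errors to $\bar M$ such that, whenever two of them, $E$ and $E'$, have the same syndrome, $E^\dagger E'$ acts on the code space as $\pi(E)^\dagger\pi(E')$ up to phase. 2. The code transmutes these errors to $\bar M$: there is a single completely positive trace-preserving map $\mathcal R$ such that for every noise channel $\mathcal E$ with Kraus operators proportional to Pauli errors of weight at most $w$ there is a channel $\mathcal M$ with Kraus operators proportional to elements of $M$ such that $\mathcal R\circ\mathcal E(\rho)=\mathcal M(\rho)$ for every state $\rho$ on the code space. 3. This $w$ is optimal: it is the largest weight such that, for some isomorphism of the logical Pauli group on two qubits with $N(S)/S$, the set of all Pauli errors of weight at most $w$ satisfies the error transmuting conditions for $\bar M$. Thus the effective distance in the sense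 $d_{\mathrm{eff}}=2w+1$ is the largest odd integer not exceeding $\tfrac32L$. -/

import Mathlib

noncomputable section

/-! ## Pauli operators and stabiliser codes, up to global phases -/

/-- The Pauli group on the qubits `E` modulo global phases: `(x, z)` is the class of
`⨂ₑ X ^ x e * Z ^ z e`. The group law is written additively. -/
abbrev Pauli (E : Type) : Type := (E → ZMod 2) × (E → ZMod 2)

/-- Number of tensor factors different from the identity. -/
def pauliWeight {E : Type} [Fintype E] (p : Pauli E) : ℕ :=
  (Finset.univ.filter fun e => p.1 e ≠ 0 ∨ p.2 e ≠ 0).card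

/-- The commutation form: `0` if the two Pauli operators commute, `1` if they anticommute. -/
def pauliComm {E : Type} [Fintype E] (p q : Pauli E) : ZMod 2 :=
  ∑ e, (p.1 e * q.2 e + p.2 e * q.1 e)

/-- The product of `Z` over a chain. -/
def zOp {E : Type} (c : E → ZMod 2) : Pauli E := (0, c)

/-- The product of `X` over a cochain. -/
def xOp {E : Type} (c : E → ZMod 2) : Pauli E := (c, 0)

/-- The normaliser `N(S)`, which for the Pauli group is the centraliser of `S`. -/
def pauliNormaliser {E : Type} [Fintype E] (S : Submodule (ZMod 2) (Pauli E)) :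
    Submodule (ZMod 2) (Pauli E) where
  carrier := {p | ∀ g ∈ S, pauliComm p g = 0}
  zero_mem' := by
    intro g _
    simp [pauliComm]
  add_mem' := by
    intro a b ha hb g hg
    have h : pauliComm (a + b) g = pauliComm a g + pauliComm b g := by
      simp only [pauliComm, ← Finset.sum_add_distrib]
      refine Finset.sum_congr rfl fun e _ => ?_
      simp only [Prod.fst_add, Prod.snd_add, Pi.add_apply]
      ring
    rw [h, ha g hg, hb g hg, add_zero]
  smul_mem' := by
    intro t a ha g hg
    have h : pauliComm (t • a) g = t * pauliComm a g := by
      simp only [pauliComm, Finset.mul_sum]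
      refine Finset.sum_congr rfl fun e _ => ?_
      simp only [Prod.smul_fst, Prod.smul_snd, Pi.smul_apply, smul_eq_mul]
      ring
    rw [h, ha g hg, mul_zero]

/-- The quotient `N(S)/S`. -/
abbrev LogicalQuotient {E : Type} [Fintype E] (S : Submodule (ZMod 2) (Pauli E)) : Type :=
  pauliNormaliser S ⧸ S.submoduleOf (pauliNormaliser S)

/-- The coset in `N(S)/S` of an element of `N(S)`. -/
def logicalClass {E : Type} [Fintype E] (S : Submodule (ZMod 2) (Pauli E))
    (p : pauliNormaliser S) : LogicalQuotient S := Submodule.Quotient.mk p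

/-- An isomorphism of the logical Pauli group on `k` qubits with `N(S)/S`. Modulo phases, an
isomorphism of Pauli groups is a group isomorphism that preserves commutation relations. -/
structure LogicalIso {E : Type} [Fintype E] (S : Submodule (ZMod 2) (Pauli E)) (k : ℕ) where
  toEquiv : Pauli (Fin k) ≃+ LogicalQuotient S
  comm_eq : ∀ (a b : Pauli (Fin k)) (p q : pauliNormaliser S),
    toEquiv a = logicalClass S p → toEquiv b = logicalClass S q →
      pauliComm (p : Pauli E) (q : Pauli E) = pauliComm a b

/-- The physical operator `p` lies in `N(S)` and represents the logical Pauli operator `a`. -/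
def LogicalIso.Represents {E : Type} [Fintype E] {S : Submodule (ZMod 2) (Pauli E)} {k : ℕ}
    (A : LogicalIso S k) (p : Pauli E) (a : Pauli (Fin k)) : Prop :=
  ∃ q : pauliNormaliser S, (q : Pauli E) = p ∧ A.toEquiv a = logicalClass S q

/-- The lift to `N(S)` of a set of logical Pauli operators. -/
def LogicalIso.lift {E : Type} [Fintype E] {S : Submodule (ZMod 2) (Pauli E)} {k : ℕ}
    (A : LogicalIso S k) (M : Set (Pauli (Fin k))) : Set (Pauli E) :=
  {p | ∃ a ∈ M, A.Represents p a}

/-- The logical bit flip on qubit `i`. -/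
def logicalX {k : ℕ} (i : Fin k) : Pauli (Fin k) := xOp (Pi.single i 1)

/-- The logical phase flip on qubit `i`. -/
def logicalZ {k : ℕ} (i : Fin k) : Pauli (Fin k) := zOp (Pi.single i 1)

/-- The algebraic error transmuting conditions: there is a map `π` from the physical errors to the
admissible logical errors such that, for physical errors `e`, `e'` in the same coset of `N(S)`
(same syndrome), `e⁻¹ e'` acts on the code space as `(π e)⁻¹ (π e')`. (A map on all physical errors
is the same as a family of maps, one for each coset.) -/
def TransmutingConditions {E : Type} [Fintype E] {S : Submodule (ZMod 2) (Pauli E)} {k : ℕ}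
    (A : LogicalIso S k) (errors : Set (Pauli E)) (M : Set (Pauli (Fin k))) : Prop :=
  ∃ π : Pauli E → Pauli (Fin k), (∀ e ∈ errors, π e ∈ M) ∧
    ∀ e ∈ errors, ∀ e' ∈ errors, -e + e' ∈ pauliNormaliser S →
      A.Represents (-e + e') (-π e + π e')

/-- `d = 2 w + 1`, where `w` is the largest weight such that, for some choice of the isomorphism of
the logical Pauli group with `N(S)/S`, the set of all Pauli errors of weight at most `w` satisfies
the error transmuting conditions. -/
def IsEffectiveDistance {E : Type} [Fintype E] (S : Submodule (ZMod 2) (Pauli E)) {k : ℕ}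
    (M : Set (Pauli (Fin k))) (d : ℕ) : Prop :=
  ∃ w : ℕ, IsGreatest
    {w : ℕ | ∃ A : LogicalIso S k, TransmutingConditions A {p | pauliWeight p ≤ w} M} w ∧
    d = 2 * w + 1

/-! ## The code of a cellulated surface

The cellulation enters through its incidence matrices modulo 2: `D₁` between vertices and edges and
`D₂` between edges and faces. -/

/-- The `1`-cycles, the kernel of `∂₁`. -/
abbrev cycles {V E : Type} [Fintype E] (D₁ : Matrix V E (ZMod 2)) :
    Submodule (ZMod 2) (E → ZMod 2) := LinearMap.ker D₁.mulVecLin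

/-- The `1`-boundaries, the image of `∂₂`. -/
abbrev boundaries {E F : Type} [Fintype F] (D₂ : Matrix E F (ZMod 2)) :
    Submodule (ZMod 2) (E → ZMod 2) := LinearMap.range D₂.mulVecLin

/-- The `1`-cocycles, the kernel of the coboundary map from `1`-cochains to `2`-cochains. -/
abbrev cocycles {E F : Type} [Fintype E] (D₂ : Matrix E F (ZMod 2)) :
    Submodule (ZMod 2) (E → ZMod 2) := LinearMap.ker D₂.transpose.mulVecLin

/-- The `1`-coboundaries, the image of the coboundary map from `0`-cochains to `1`-cochains. -/
abbrev coboundaries {V E : Type} [Fintype V] (D₁ : Matrix V E (ZMod 2)) :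
    Submodule (ZMod 2) (E → ZMod 2) := LinearMap.range D₁.transpose.mulVecLin

/-- `H₁` of the cellulation with coefficients modulo 2. -/
abbrev homology {V E F : Type} [Fintype E] [Fintype F]
    (D₁ : Matrix V E (ZMod 2)) (D₂ : Matrix E F (ZMod 2)) : Type :=
  cycles D₁ ⧸ (boundaries D₂).submoduleOf (cycles D₁)

/-- `H¹` of the cellulation with coefficients modulo 2. -/
abbrev cohomology {V E F : Type} [Fintype V] [Fintype E]
    (D₁ : Matrix V E (ZMod 2)) (D₂ : Matrix E F (ZMod 2)) : Type :=
  cocycles D₂ ⧸ (coboundaries D₁).submoduleOf (cocycles D₂)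

/-- The homology class of a cycle. -/
def homologyClass {V E F : Type} [Fintype E] [Fintype F]
    (D₁ : Matrix V E (ZMod 2)) (D₂ : Matrix E F (ZMod 2)) (c : cycles D₁) : homology D₁ D₂ :=
  Submodule.Quotient.mk c

/-- The cohomology class of a cocycle. -/
def cohomologyClass {V E F : Type} [Fintype V] [Fintype E]
    (D₁ : Matrix V E (ZMod 2)) (D₂ : Matrix E F (ZMod 2)) (c : cocycles D₂) : cohomology D₁ D₂ :=
  Submodule.Quotient.mk c

/-- The least weight (number of edges) of a cycle in a homology class. -/
def homologyWeight {V E F : Type} [Fintype E] [Fintype F]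
    {D₁ : Matrix V E (ZMod 2)} {D₂ : Matrix E F (ZMod 2)} (h : homology D₁ D₂) : ℕ :=
  sInf {n | ∃ c : cycles D₁, homologyClass D₁ D₂ c = h ∧ hammingNorm (c : E → ZMod 2) = n}

/-- The least weight (number of edges) of a cocycle in a cohomology class. -/
def cohomologyWeight {V E F : Type} [Fintype V] [Fintype E]
    {D₁ : Matrix V E (ZMod 2)} {D₂ : Matrix E F (ZMod 2)} (h : cohomology D₁ D₂) : ℕ :=
  sInf {n | ∃ c : cocycles D₂, cohomologyClass D₁ D₂ c = h ∧ hammingNorm (c : E → ZMod 2) = n}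

/-- The stabiliser generators: `Z` on the boundary of each face and `X` on the coboundary of each
vertex. -/
def stabiliserGenerators {V E F : Type} (D₁ : Matrix V E (ZMod 2)) (D₂ : Matrix E F (ZMod 2)) :
    Set (Pauli E) :=
  (Set.range fun f : F => zOp fun e => D₂ e f) ∪ (Set.range fun v : V => xOp fun e => D₁ v e)

/-- The stabiliser group of the code of a cellulated surface. -/
def surfaceStabiliser {V E F : Type} (D₁ : Matrix V E (ZMod 2)) (D₂ : Matrix E F (ZMod 2)) :
    Submodule (ZMod 2) (Pauli E) :=
  Submodule.span (ZMod 2) (stabiliserGenerators D₁ D₂)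

/-! ## Operators, channels and error transmutation -/

/-- Operators on the Hilbert space of the qubits `E`, in the computational basis. -/
abbrev QubitOp (E : Type) : Type := Matrix (E → Fin 2) (E → Fin 2) ℂ

/-- The one-qubit operator `X ^ x * Z ^ z`. -/
def singlePauli (x z : ZMod 2) : Matrix (Fin 2) (Fin 2) ℂ :=
  !![0, 1; 1, 0] ^ x.val * !![1, 0; 0, -1] ^ z.val

/-- The tensor product over all qubits of the operators `X ^ x e * Z ^ z e`. -/
def pauliMatrix {E : Type} [Fintype E] (p : Pauli E) : QubitOp E :=
  Matrix.of fun a b => ∏ e, singlePauli (p.1 e) (p.2 e) (a e) (b e)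

/-- The Pauli channel `ρ ↦ ∑ₚ r p • p ρ p†`. -/
def pauliChannel {E : Type} [Fintype E] [DecidableEq E] (r : Pauli E → ℝ) (ρ : QubitOp E) :
    QubitOp E :=
  ∑ p, (r p : ℂ) • (pauliMatrix p * ρ * (pauliMatrix p).conjTranspose)

/-- `r` is a probability distribution on Pauli operators that is supported in `T`. -/
def IsPauliDistribution {E : Type} [Fintype E] [DecidableEq E] (T : Set (Pauli E))
    (r : Pauli E → ℝ) : Prop :=
  (∀ p, 0 ≤ r p) ∧ ∑ p, r p = 1 ∧ ∀ p, p ∉ T → r p = 0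

open scoped ComplexOrder in
/-- `ρ` is a density operator supported on the code space, the common `+1` eigenspace of the
stabiliser generators. -/
def IsCodeState {V E F : Type} [Fintype E] [DecidableEq E]
    (D₁ : Matrix V E (ZMod 2)) (D₂ : Matrix E F (ZMod 2)) (ρ : QubitOp E) : Prop :=
  ρ.PosSemidef ∧ ρ.trace = 1 ∧ ∀ g ∈ stabiliserGenerators D₁ D₂, pauliMatrix g * ρ = ρ

/-- The code transmutes the physical errors to the admissible logical errors `M`: one recovery
operation (a completely positive trace-preserving map, with Kraus operators `R i`) turns every noise
channel with Kraus operators proportional to physical errors into a channel on the code space with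
Kraus operators proportional to elements of the lift of `M`. -/
def IsTransmutingCode {V E F : Type} [Fintype E] [DecidableEq E]
    (D₁ : Matrix V E (ZMod 2)) (D₂ : Matrix E F (ZMod 2)) {k : ℕ}
    (A : LogicalIso (surfaceStabiliser D₁ D₂) k) (errors : Set (Pauli E))
    (M : Set (Pauli (Fin k))) : Prop :=
  ∃ (m : ℕ) (R : Fin m → QubitOp E), ∑ i, (R i).conjTranspose * R i = 1 ∧
    ∀ r, IsPauliDistribution errors r → ∃ q, IsPauliDistribution (A.lift M) q ∧
      ∀ ρ, IsCodeState D₁ D₂ ρ →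
        ∑ i, R i * pauliChannel r ρ * (R i).conjTranspose = pauliChannel q ρ

/-! ## The `L × L` hexagonal lattice on a torus

The lattice is drawn as a brick wall with `L` rows of `L` bricks (hexagons) in which consecutive rows
are shifted by half a brick; opposite sides of the resulting rectangle are identified, which is
consistent when `L` is even. The vertices are the points `(i, j)` with `i` modulo `2 L` and `j`
modulo `L`. -/

/-- Vertices `(i, j)`: column `i`, row `j`. -/
abbrev HexVertex (L : ℕ) : Type := ZMod (2 * L) × ZMod L

/-- Edges: `Sum.inl (i, j)` joins `(i, j)` and `(i + 1, j)`; `Sum.inr (k, j)` is the `k`-th vertical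
edge between rows `j` and `j + 1`. -/
abbrev HexEdge (L : ℕ) : Type := (ZMod (2 * L) × ZMod L) ⊕ (ZMod L × ZMod L)

/-- Faces: `(k, j)` is the hexagon between rows `j` and `j + 1` bounded on the left by the `k`-th and
on the right by the `(k + 1)`-th vertical edge. -/
abbrev HexFace (L : ℕ) : Type := ZMod L × ZMod L

/-- The column `2 k` (for even `j`) or `2 k + 1` (for odd `j`) of the `k`-th vertical edge between
rows `j` and `j + 1`. -/
def hexColumn (L : ℕ) (k j : ZMod L) : ZMod (2 * L) := ((2 * k.val + j.val % 2 : ℕ) : ZMod (2 * L))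

/-- The two end points of an edge. -/
def hexEnds (L : ℕ) : HexEdge L → HexVertex L × HexVertex L
  | Sum.inl (i, j) => ((i, j), (i + 1, j))
  | Sum.inr (k, j) => ((hexColumn L k j, j), (hexColumn L k j, j + 1))

/-- The six edges of a hexagon. -/
def hexSides (L : ℕ) (f : HexFace L) : Finset (HexEdge L) :=
  {Sum.inl (hexColumn L f.1 f.2, f.2), Sum.inl (hexColumn L f.1 f.2 + 1, f.2),
    Sum.inl (hexColumn L f.1 f.2, f.2 + 1), Sum.inl (hexColumn L f.1 f.2 + 1, f.2 + 1),
    Sum.inr (f.1, f.2), Sum.inr (f.1 + 1, f.2)}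

/-- The vertex-edge incidence matrix. -/
def hexD₁ (L : ℕ) : Matrix (HexVertex L) (HexEdge L) (ZMod 2) :=
  Matrix.of fun v e => if v = (hexEnds L e).1 ∨ v = (hexEnds L e).2 then 1 else 0

/-- The edge-face incidence matrix. -/
def hexD₂ (L : ℕ) : Matrix (HexEdge L) (HexFace L) (ZMod 2) :=
  Matrix.of fun e f => if e ∈ hexSides L f then 1 else 0

/-- The two fundamental loops of edges: the horizontal loop along row `0`, and the vertical loop
that zigzags between columns `0` and `1`. -/
def hexLoop (L : ℕ) : Fin 2 → HexEdge L → ZMod 2 :=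
  ![Sum.elim (fun p => if p.2 = 0 then 1 else 0) (fun _ => 0),
    Sum.elim (fun p => if p.1 = 0 then 1 else 0) (fun p => if p.1 = 0 then 1 else 0)]

/-- The two fundamental loops of the dual lattice, each given by the edges it crosses: the vertical
one, which crosses the horizontal edges between columns `0` and `1`, and the horizontal one, which
crosses the vertical edges between rows `0` and `1`. -/
def hexCoLoop (L : ℕ) : Fin 2 → HexEdge L → ZMod 2 :=
  ![Sum.elim (fun p => if p.1 = 0 then 1 else 0) (fun _ => 0),
    Sum.elim (fun _ => 0) (fun p => if p.2 = 0 then 1 else 0)]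

/-- The stabiliser group of the toric code on the `L × L` hexagonal lattice. -/
abbrev hexStabiliser (L : ℕ) : Submodule (ZMod 2) (Pauli (HexEdge L)) :=
  surfaceStabiliser (hexD₁ L) (hexD₂ L)

/-- The admissible logical errors on two qubits: the identity and the two single bit flips. -/
def singleBitFlips : Set (Pauli (Fin 2)) := {0, logicalX 0, logicalX 1}

end

open Matrix

set_option linter.unusedSectionVars false

/-! ## Stabiliser codes of cellulated surfaces -/

/-! Modulo phases, `S` consists of the pairs (coboundary, boundary) and `N(S)` of the pairs
(cocycle, cycle), so everything is governed by the mod 2 intersection pairing of cocycles with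
cycles. Two loops and two dual loops with identity intersection matrix give coordinates on `N(S)/S`
once they detect triviality (`DualLoops`). Detection is a dimension count: the lattice and its dual
are connected, which fixes both ranks and leaves two dimensions of homology and of cohomology
(`finrank_cycles_hexD₁`, `mem_of_finrank_eq_add`).

Weights are bounded below by counting intersections with all translates of a loop
(`card_le_of_dotProduct_ne_zero`). Let a cocycle have `h` horizontal and `v` vertical edges. If it
is odd on rows, the `L` disjoint row loops give `h ≥ L`; if it is odd on zigzags, the `2L` zigzags,
which use each vertical edge twice, give `h + 2v ≥ 2L`. Together they give `h + v ≥ 3L/2` for the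
diagonal class. A nontrivial cycle has at least `2L` edges. Hence an element of `N(S)` of weight
below `3L/2` represents an element of `{I, X₁, X₂}`. Explicit paths attain the bounds.

Two errors of weight at most `w` with one syndrome have a product of weight at most `2w < 3L/2`;
comparing every error with a reference error of its syndrome defines `π`. A correction chosen for
each syndrome then yields the recovery map (`TransmutingConditions.isTransmutingCode`).

For optimality, two antipodal faces are joined by four dual paths of length at most `⌈3L/4⌉`, one
for each class (`exists_antipodal_paths`). They have the same syndrome but are pairwise
inequivalent, so `π` would need four values, and only three are admissible. This does not depend on
the choice of logical operators. -/

theorem pauliComm_eq_dotProduct {E : Type} [Fintype E] (p q : Pauli E) :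
    pauliComm p q = p.1 ⬝ᵥ q.2 + p.2 ⬝ᵥ q.1 := by
  simp [pauliComm, dotProduct, Finset.sum_add_distrib]

theorem pauliComm_add_left {E : Type} [Fintype E] (p q r : Pauli E) :
    pauliComm (p + q) r = pauliComm p r + pauliComm q r := by
  simp only [pauliComm_eq_dotProduct, Prod.fst_add, Prod.snd_add, add_dotProduct]
  ring

theorem pauliComm_comm {E : Type} [Fintype E] (p q : Pauli E) :
    pauliComm p q = pauliComm q p := by
  simp only [pauliComm_eq_dotProduct, dotProduct_comm p.1, dotProduct_comm p.2]
  ring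

theorem pauliComm_add_right {E : Type} [Fintype E] (p q r : Pauli E) :
    pauliComm p (q + r) = pauliComm p q + pauliComm p r := by
  rw [pauliComm_comm, pauliComm_add_left, pauliComm_comm q, pauliComm_comm r]

theorem mem_pauliNormaliser {E : Type} [Fintype E] {S : Submodule (ZMod 2) (Pauli E)}
    {p : Pauli E} : p ∈ pauliNormaliser S ↔ ∀ g ∈ S, pauliComm p g = 0 := Iff.rfl

theorem Pauli.neg_eq {E : Type} (p : Pauli E) : -p = p := by
  ext e <;> simp [ZMod.neg_eq_self_mod_two]

theorem Pauli.add_self {E : Type} (p : Pauli E) : p + p = 0 := by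
  nth_rewrite 1 [← Pauli.neg_eq p]
  exact neg_add_cancel p

theorem pauliWeight_add_le {E : Type} [Fintype E] (p q : Pauli E) :
    pauliWeight (p + q) ≤ pauliWeight p + pauliWeight q := by
  classical
  unfold pauliWeight
  refine le_trans (Finset.card_le_card ?_) (Finset.card_union_le _ _)
  intro e he
  simp only [Finset.mem_filter, Finset.mem_univ, true_and, Finset.mem_union, Prod.fst_add,
    Prod.snd_add, Pi.add_apply] at he ⊢
  by_contra! h
  obtain ⟨⟨h1, h2⟩, h3, h4⟩ := h
  simp [h1, h2, h3, h4] at he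

theorem hammingNorm_fst_le_pauliWeight {E : Type} [Fintype E] (p : Pauli E) :
    hammingNorm p.1 ≤ pauliWeight p :=
  Finset.card_le_card fun e he => by simp_all

theorem hammingNorm_snd_le_pauliWeight {E : Type} [Fintype E] (p : Pauli E) :
    hammingNorm p.2 ≤ pauliWeight p :=
  Finset.card_le_card fun e he => by simp_all

theorem pauliWeight_xOp {E : Type} [Fintype E] (c : E → ZMod 2) :
    pauliWeight (xOp c) = hammingNorm c := by
  simp [pauliWeight, xOp, hammingNorm]

theorem hammingNorm_add_le {E : Type} [Fintype E] (a b : E → ZMod 2) :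
    hammingNorm (a + b) ≤ hammingNorm a + hammingNorm b := by
  have := pauliWeight_add_le (xOp a) (xOp b)
  rwa [show xOp a + xOp b = xOp (a + b) by simp [xOp], pauliWeight_xOp, pauliWeight_xOp,
    pauliWeight_xOp] at this

/-! ### Stabiliser, normaliser and logical operators in terms of chains -/

section Surface

variable {V E F : Type} [Fintype V] [Fintype F]
  {D₁ : Matrix V E (ZMod 2)} {D₂ : Matrix E F (ZMod 2)}

/-- The face generators involve only the `Z` coordinate and the vertex generators only the `X`
coordinate, so their span is a product of two column spaces. -/
theorem mem_surfaceStabiliser {p : Pauli E} :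
    p ∈ surfaceStabiliser D₁ D₂ ↔ p.1 ∈ coboundaries D₁ ∧ p.2 ∈ boundaries D₂ := by
  classical
  have h1 : Submodule.span (ZMod 2) (Set.range fun f : F => zOp fun e => D₂ e f) =
      (boundaries D₂).map (LinearMap.inr (ZMod 2) (E → ZMod 2) (E → ZMod 2)) := by
    rw [boundaries, Matrix.range_mulVecLin, Submodule.map_span, ← Set.range_comp]
    rfl
  have h2 : Submodule.span (ZMod 2) (Set.range fun v : V => xOp fun e => D₁ v e) =
      (coboundaries D₁).map (LinearMap.inl (ZMod 2) (E → ZMod 2) (E → ZMod 2)) := by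
    rw [coboundaries, Matrix.range_mulVecLin, Submodule.map_span, ← Set.range_comp]
    rfl
  rw [surfaceStabiliser, stabiliserGenerators, Submodule.span_union, h1, h2, sup_comm,
    ← LinearMap.prod_eq_sup_map, Submodule.mem_prod]

variable [Fintype E]

theorem mem_pauliNormaliser_surfaceStabiliser {p : Pauli E} :
    p ∈ pauliNormaliser (surfaceStabiliser D₁ D₂) ↔ p.1 ∈ cocycles D₂ ∧ p.2 ∈ cycles D₁ := by
  constructor
  · intro h
    constructor
    · rw [LinearMap.mem_ker]
      ext f
      have := h (zOp fun e => D₂ e f) (Submodule.subset_span (Or.inl ⟨f, rfl⟩))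
      rw [pauliComm_eq_dotProduct] at this
      simp only [zOp, dotProduct_zero, add_zero] at this
      rw [dotProduct_comm] at this
      rw [mulVecLin_apply, mulVec_transpose]
      exact (dotProduct_comm _ _).trans this
    · rw [LinearMap.mem_ker]
      ext v
      have := h (xOp fun e => D₁ v e) (Submodule.subset_span (Or.inr ⟨v, rfl⟩))
      rw [pauliComm_eq_dotProduct] at this
      simp only [xOp, dotProduct_zero, zero_add] at this
      rw [dotProduct_comm] at this
      simpa [Matrix.mulVec, dotProduct] using this
  · rintro ⟨h1, h2⟩ g hg
    rw [mem_surfaceStabiliser] at hg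
    obtain ⟨⟨y, hy⟩, ⟨w, hw⟩⟩ := hg
    rw [LinearMap.mem_ker, mulVecLin_apply] at h1 h2
    rw [mulVecLin_apply] at hy hw
    rw [pauliComm_eq_dotProduct, ← hy, ← hw, dotProduct_mulVec, dotProduct_mulVec,
      ← mulVec_transpose, h1, vecMul_transpose, h2]
    simp

theorem cocycles_dotProduct_boundaries {x z : E → ZMod 2} (hx : x ∈ cocycles D₂)
    (hz : z ∈ boundaries D₂) : x ⬝ᵥ z = 0 := by
  obtain ⟨w, rfl⟩ := hz
  rw [LinearMap.mem_ker, mulVecLin_apply] at hx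
  rw [mulVecLin_apply, dotProduct_mulVec, ← mulVec_transpose, hx, zero_dotProduct]

theorem coboundaries_dotProduct_cycles {x z : E → ZMod 2} (hx : x ∈ coboundaries D₁)
    (hz : z ∈ cycles D₁) : x ⬝ᵥ z = 0 := by
  obtain ⟨w, rfl⟩ := hx
  rw [LinearMap.mem_ker, mulVecLin_apply] at hz
  rw [mulVecLin_apply, dotProduct_comm, dotProduct_mulVec, vecMul_transpose, hz, zero_dotProduct]

/-- Cycles and cocycles that represent dual bases of homology and cohomology. -/
structure DualLoops (D₁ : Matrix V E (ZMod 2)) (D₂ : Matrix E F (ZMod 2)) (k : ℕ) where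
  z : Fin k → cycles D₁
  x : Fin k → cocycles D₂
  pairing : ∀ i j, (x i : E → ZMod 2) ⬝ᵥ (z j : E → ZMod 2) = if i = j then 1 else 0
  mem_boundaries : ∀ c ∈ cycles D₁, (∀ i, (x i : E → ZMod 2) ⬝ᵥ c = 0) → c ∈ boundaries D₂
  mem_coboundaries : ∀ c ∈ cocycles D₂, (∀ i, c ⬝ᵥ (z i : E → ZMod 2) = 0) →
    c ∈ coboundaries D₁

namespace DualLoops

variable {k : ℕ} (B : DualLoops D₁ D₂ k)

/-- Subtracting from `z` its expansion in the loops leaves a cycle that no dual loop detects, hence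
a boundary, on which cocycles vanish. This makes the logical coordinates symplectic, and later
allows translates of loops to be compared through intersection numbers alone. -/
theorem dotProduct_eq {x z : E → ZMod 2} (hx : x ∈ cocycles D₂) (hz : z ∈ cycles D₁) :
    x ⬝ᵥ z = ∑ i, (x ⬝ᵥ (B.z i : E → ZMod 2)) * ((B.x i : E → ZMod 2) ⬝ᵥ z) := by
  have hmem : z - ∑ i, ((B.x i : E → ZMod 2) ⬝ᵥ z) • (B.z i : E → ZMod 2) ∈ boundaries D₂ := by
    refine B.mem_boundaries _ (sub_mem hz (sum_mem fun i _ =>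
      Submodule.smul_mem _ _ (B.z i).2)) fun i => ?_
    rw [dotProduct_sub, dotProduct_sum]
    simp [dotProduct_smul, B.pairing]
  have h := cocycles_dotProduct_boundaries hx hmem
  rw [dotProduct_sub, sub_eq_zero, dotProduct_sum] at h
  rw [h]
  refine Finset.sum_congr rfl fun i _ => ?_
  rw [dotProduct_smul, smul_eq_mul, mul_comm]

/-- The logical Pauli operator represented by an element of the normaliser. -/
def toLogical : pauliNormaliser (surfaceStabiliser D₁ D₂) →ₗ[ZMod 2] Pauli (Fin k) where
  toFun p := (fun i => (p : Pauli E).1 ⬝ᵥ (B.z i : E → ZMod 2),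
    fun i => (B.x i : E → ZMod 2) ⬝ᵥ (p : Pauli E).2)
  map_add' p q := by
    ext i <;> simp [add_dotProduct, dotProduct_add]
  map_smul' t p := by
    ext i <;> simp [dotProduct_smul]

theorem ker_toLogical : LinearMap.ker B.toLogical =
    (surfaceStabiliser D₁ D₂).submoduleOf (pauliNormaliser (surfaceStabiliser D₁ D₂)) := by
  ext p
  have hp := mem_pauliNormaliser_surfaceStabiliser.1 p.2
  rw [LinearMap.mem_ker, Submodule.submoduleOf, Submodule.mem_comap, Submodule.subtype_apply,
    mem_surfaceStabiliser, toLogical]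
  simp only [LinearMap.coe_mk, AddHom.coe_mk, Prod.mk_eq_zero]
  constructor
  · rintro ⟨h1, h2⟩
    exact ⟨B.mem_coboundaries _ hp.1 (congrFun h1), B.mem_boundaries _ hp.2 (congrFun h2)⟩
  · rintro ⟨h1, h2⟩
    exact ⟨funext fun i => coboundaries_dotProduct_cycles h1 (B.z i).2,
      funext fun i => cocycles_dotProduct_boundaries (B.x i).2 h2⟩

theorem sum_smul_x_dotProduct (a : Fin k → ZMod 2) (j : Fin k) :
    (∑ i, a i • (B.x i : E → ZMod 2)) ⬝ᵥ (B.z j : E → ZMod 2) = a j := by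
  simp only [sum_dotProduct, smul_dotProduct, B.pairing, smul_eq_mul, mul_ite, mul_one,
    mul_zero, Finset.sum_ite_eq', Finset.mem_univ, if_true]

theorem x_dotProduct_sum_smul (a : Fin k → ZMod 2) (j : Fin k) :
    (B.x j : E → ZMod 2) ⬝ᵥ (∑ i, a i • (B.z i : E → ZMod 2)) = a j := by
  simp only [dotProduct_sum, dotProduct_smul, B.pairing, smul_eq_mul, mul_ite, mul_one,
    mul_zero, Finset.sum_ite_eq, Finset.mem_univ, if_true]

theorem toLogical_surjective : Function.Surjective B.toLogical := by
  intro a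
  have h1 : ∑ i, a.1 i • (B.x i : E → ZMod 2) ∈ cocycles D₂ :=
    Submodule.sum_mem _ fun i _ => Submodule.smul_mem _ (a.1 i) (B.x i).2
  have h2 : ∑ i, a.2 i • (B.z i : E → ZMod 2) ∈ cycles D₁ :=
    Submodule.sum_mem _ fun i _ => Submodule.smul_mem _ (a.2 i) (B.z i).2
  exact ⟨⟨(_, _), mem_pauliNormaliser_surfaceStabiliser.2 ⟨h1, h2⟩⟩,
    Prod.ext (funext (B.sum_smul_x_dotProduct a.1)) (funext (B.x_dotProduct_sum_smul a.2))⟩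

/-- The identification of the logical Pauli group with `N(S)/S`. -/
noncomputable def quotientEquiv :
    LogicalQuotient (surfaceStabiliser D₁ D₂) ≃ₗ[ZMod 2] Pauli (Fin k) :=
  (Submodule.quotEquivOfEq _ _ B.ker_toLogical.symm).trans
    (B.toLogical.quotKerEquivOfSurjective B.toLogical_surjective)

theorem quotientEquiv_logicalClass (p : pauliNormaliser (surfaceStabiliser D₁ D₂)) :
    B.quotientEquiv (logicalClass _ p) = B.toLogical p := rfl

theorem pauliComm_toLogical (p q : pauliNormaliser (surfaceStabiliser D₁ D₂)) :
    pauliComm (B.toLogical p) (B.toLogical q) = pauliComm (p : Pauli E) (q : Pauli E) := by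
  have hp := mem_pauliNormaliser_surfaceStabiliser.1 p.2
  have hq := mem_pauliNormaliser_surfaceStabiliser.1 q.2
  rw [pauliComm_eq_dotProduct, pauliComm_eq_dotProduct, B.dotProduct_eq hp.1 hq.2,
    dotProduct_comm (p : Pauli E).2, B.dotProduct_eq hq.1 hp.2,
    dotProduct_comm (B.toLogical p).2]
  rfl

/-- The isomorphism of Pauli groups given by dual bases of homology and cohomology. -/
noncomputable def logicalIso : LogicalIso (surfaceStabiliser D₁ D₂) k where
  toEquiv := B.quotientEquiv.symm.toAddEquiv
  comm_eq a b p q ha hb := by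
    have ha' : B.quotientEquiv.symm a = logicalClass _ p := ha
    have hb' : B.quotientEquiv.symm b = logicalClass _ q := hb
    rw [LinearEquiv.symm_apply_eq, quotientEquiv_logicalClass] at ha' hb'
    rw [ha', hb', pauliComm_toLogical]

theorem represents_iff {p : Pauli E} {a : Pauli (Fin k)} :
    B.logicalIso.Represents p a ↔ p ∈ pauliNormaliser (surfaceStabiliser D₁ D₂) ∧
      (fun i => p.1 ⬝ᵥ (B.z i : E → ZMod 2)) = a.1 ∧
      (fun i => (B.x i : E → ZMod 2) ⬝ᵥ p.2) = a.2 := by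
  have key : ∀ q : pauliNormaliser (surfaceStabiliser D₁ D₂),
      B.logicalIso.toEquiv a = logicalClass _ q ↔ B.toLogical q = a := by
    intro q
    change B.quotientEquiv.symm a = logicalClass _ q ↔ _
    rw [LinearEquiv.symm_apply_eq, quotientEquiv_logicalClass, eq_comm]
  constructor
  · rintro ⟨q, rfl, h⟩
    rw [key] at h
    exact ⟨q.2, congrArg Prod.fst h, congrArg Prod.snd h⟩
  · rintro ⟨hp, h1, h2⟩
    exact ⟨⟨p, hp⟩, rfl, (key _).2 (Prod.ext h1 h2)⟩

end DualLoops

end Surface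

/-! ### Transmuting conditions: a sufficient weight bound and an obstruction by counting -/

section Transmuting

variable {E : Type} [Fintype E] {S : Submodule (ZMod 2) (Pauli E)} {k : ℕ}

namespace LogicalIso

theorem Represents.mem {A : LogicalIso S k} {p : Pauli E} {a : Pauli (Fin k)}
    (h : A.Represents p a) : p ∈ pauliNormaliser S := by
  obtain ⟨q, rfl, -⟩ := h
  exact q.2

theorem Represents.add {A : LogicalIso S k} {p q : Pauli E} {a b : Pauli (Fin k)}
    (ha : A.Represents p a) (hb : A.Represents q b) : A.Represents (p + q) (a + b) := by
  obtain ⟨p, rfl, hp⟩ := ha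
  obtain ⟨q, rfl, hq⟩ := hb
  exact ⟨p + q, rfl, by rw [map_add, hp, hq]; rfl⟩

theorem Represents.mem_stabiliser {A : LogicalIso S k} {p : Pauli E} (h : A.Represents p 0) :
    p ∈ S := by
  obtain ⟨p, rfl, hp⟩ := h
  rw [map_zero] at hp
  exact (Submodule.Quotient.mk_eq_zero (S.submoduleOf (pauliNormaliser S))).1 hp.symm

end LogicalIso

/-- The errors of weight at most `w` satisfy the transmuting conditions when all logical operators
of weight at most `2 w` are admissible. -/
theorem transmutingConditions_of_weight_le (A : LogicalIso S k) {M : Set (Pauli (Fin k))}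
    {w : ℕ}
    (h : ∀ p ∈ pauliNormaliser S, pauliWeight p ≤ 2 * w → p ∈ A.lift M) :
    TransmutingConditions A {p | pauliWeight p ≤ w} M := by
  classical
  let N := pauliNormaliser S
  -- A reference error for each syndrome; the default `0` concerns syndromes without an error of
  -- weight at most `w` and plays no role.
  let base : (Pauli E ⧸ N) → Pauli E := fun c =>
    if hc : ∃ e, pauliWeight e ≤ w ∧ (Submodule.Quotient.mk e : Pauli E ⧸ N) = c
      then hc.choose else 0
  have hbase : ∀ e, pauliWeight e ≤ w → pauliWeight (base (Submodule.Quotient.mk e)) ≤ w ∧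
      base (Submodule.Quotient.mk e) + e ∈ N := by
    intro e he
    have hc : ∃ e', pauliWeight e' ≤ w ∧
      (Submodule.Quotient.mk e' : Pauli E ⧸ N) = Submodule.Quotient.mk e := ⟨e, he, rfl⟩
    have hb : base (Submodule.Quotient.mk e) = hc.choose := dif_pos hc
    rw [hb]
    refine ⟨hc.choose_spec.1, ?_⟩
    have := (Submodule.Quotient.eq N).1 hc.choose_spec.2
    rwa [sub_eq_add_neg, Pauli.neg_eq] at this
  -- The product of `e` with its reference error lies in `N(S)` and has weight at most `2 w`; the
  -- logical operator it represents serves as `π e`.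
  have hex : ∀ e, ∃ a, pauliWeight e ≤ w →
      a ∈ M ∧ A.Represents (base (Submodule.Quotient.mk e) + e) a := by
    intro e
    by_cases he : pauliWeight e ≤ w
    · obtain ⟨h1, h2⟩ := hbase e he
      obtain ⟨a, ha, hr⟩ := h _ h2 ((pauliWeight_add_le _ _).trans (by omega))
      exact ⟨a, fun _ => ⟨ha, hr⟩⟩
    · exact ⟨0, fun h => absurd h he⟩
  choose π hπ using hex
  refine ⟨π, fun e he => (hπ e he).1, fun e he e' he' hee => ?_⟩
  have h1 := (hπ e he).2
  have h2 := (hπ e' he').2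
  have hq : (Submodule.Quotient.mk e : Pauli E ⧸ N) = Submodule.Quotient.mk e' := by
    refine (Submodule.Quotient.eq N).2 ?_
    rw [← neg_mem_iff]
    simpa [sub_eq_add_neg, add_comm] using hee
  rw [← hq] at h2
  have h3 := h1.add h2
  rw [Pauli.neg_eq, Pauli.neg_eq]
  -- Errors of one syndrome share the reference error, which cancels.
  have : base (Submodule.Quotient.mk e) + e + (base (Submodule.Quotient.mk e) + e') = e + e' := by
    rw [add_add_add_comm, Pauli.add_self, zero_add]
  rwa [this] at h3

/-- Inequivalent errors of one coset are transmuted to different logical operators. -/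
theorem TransmutingConditions.card_le {A : LogicalIso S k} {errors : Set (Pauli E)}
    {M : Set (Pauli (Fin k))} (h : TransmutingConditions A errors M) (hM : M.Finite)
    {n : ℕ} (e : Fin n → Pauli E) (he : ∀ i, e i ∈ errors)
    (hN : ∀ i j, e i + e j ∈ pauliNormaliser S) (hS : ∀ i j, i ≠ j → e i + e j ∉ S) :
    n ≤ M.ncard := by
  obtain ⟨π, h1, h2⟩ := h
  have hinj : Function.Injective fun i => π (e i) := by
    intro i j hij
    by_contra hne
    have h3 := h2 _ (he i) _ (he j) (by rw [Pauli.neg_eq]; exact hN i j)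
    simp only at hij
    -- Equal images would make the product represent the identity, hence a stabiliser.
    rw [hij, neg_add_cancel, Pauli.neg_eq] at h3
    exact hS i j hne h3.mem_stabiliser
  have := Set.ncard_le_ncard (s := Set.range fun i => π (e i)) (t := M)
    (by rintro _ ⟨i, rfl⟩; exact h1 _ (he i)) hM
  rwa [Set.ncard_range_of_injective hinj, Nat.card_fin] at this

end Transmuting

/-! ## Pauli matrices -/

/-- The sign `(-1) ^ t`. -/
noncomputable def binarySign (t : ZMod 2) : ℂ := (-1) ^ t.val

theorem binarySign_zero : binarySign 0 = 1 := by simp [binarySign]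

theorem binarySign_one : binarySign 1 = -1 := by simp [binarySign, ZMod.val_one]

theorem ZMod.eq_zero_or_eq_one (a : ZMod 2) : a = 0 ∨ a = 1 := by
  revert a; decide

theorem binarySign_add (a b : ZMod 2) : binarySign (a + b) = binarySign a * binarySign b := by
  rcases ZMod.eq_zero_or_eq_one a with rfl | rfl <;>
    rcases ZMod.eq_zero_or_eq_one b with rfl | rfl <;>
    simp [binarySign_zero, binarySign_one, CharTwo.add_self_eq_zero]

theorem binarySign_mul_self (a : ZMod 2) : binarySign a * binarySign a = 1 := by
  rw [← binarySign_add, CharTwo.add_self_eq_zero, binarySign_zero]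

theorem star_binarySign (a : ZMod 2) : star (binarySign a) = binarySign a := by
  rcases ZMod.eq_zero_or_eq_one a with rfl | rfl <;> simp [binarySign_zero, binarySign_one]

theorem binarySign_sum {ι : Type} (s : Finset ι) (f : ι → ZMod 2) :
    binarySign (∑ i ∈ s, f i) = ∏ i ∈ s, binarySign (f i) := by
  classical
  induction s using Finset.induction_on with
  | empty => simp [binarySign_zero]
  | insert a s ha ih => rw [Finset.sum_insert ha, Finset.prod_insert ha, binarySign_add, ih]

theorem singlePauli_mul (x z x' z' : ZMod 2) :
    singlePauli x z * singlePauli x' z' =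
      binarySign (z * x') • singlePauli (x + x') (z + z') := by
  have h2 : (1 + 1 : ZMod 2) = 0 := by decide
  rcases ZMod.eq_zero_or_eq_one x with rfl | rfl <;>
    rcases ZMod.eq_zero_or_eq_one z with rfl | rfl <;>
    rcases ZMod.eq_zero_or_eq_one x' with rfl | rfl <;>
    rcases ZMod.eq_zero_or_eq_one z' with rfl | rfl <;>
    simp [singlePauli, binarySign_zero, binarySign_one, h2, ZMod.val_one, Matrix.one_fin_two]

theorem singlePauli_conjTranspose (x z : ZMod 2) :
    (singlePauli x z).conjTranspose = binarySign (x * z) • singlePauli x z := by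
  rcases ZMod.eq_zero_or_eq_one x with rfl | rfl <;>
    rcases ZMod.eq_zero_or_eq_one z with rfl | rfl <;>
    ext i j <;> fin_cases i <;> fin_cases j <;>
    simp [singlePauli, binarySign_zero, binarySign_one, ZMod.val_one, Matrix.one_fin_two]

section

variable {E : Type} [Fintype E]

theorem pauliMatrix_apply (p : Pauli E) (a b : E → Fin 2) :
    pauliMatrix p a b = ∏ e, singlePauli (p.1 e) (p.2 e) (a e) (b e) := rfl

theorem pauliMatrix_conjTranspose (p : Pauli E) :
    (pauliMatrix p).conjTranspose = binarySign (p.1 ⬝ᵥ p.2) • pauliMatrix p := by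
  ext a b
  rw [Matrix.conjTranspose_apply, Matrix.smul_apply, pauliMatrix_apply, pauliMatrix_apply,
    dotProduct, binarySign_sum, smul_eq_mul, ← Finset.prod_mul_distrib, star_prod]
  refine Finset.prod_congr rfl fun e _ => ?_
  have := congrFun (congrFun (singlePauli_conjTranspose (p.1 e) (p.2 e)) (a e)) (b e)
  simpa using this

variable [DecidableEq E]

/-- The sign counts the qubits at which a `Z` of the left factor passes an `X` of the right one.
Exchanging the sum over intermediate basis states with the product over qubits reduces this to one
qubit. -/
theorem pauliMatrix_mul (p q : Pauli E) :
    pauliMatrix p * pauliMatrix q = binarySign (p.2 ⬝ᵥ q.1) • pauliMatrix (p + q) := by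
  ext a b
  rw [Matrix.mul_apply, Matrix.smul_apply, pauliMatrix_apply, dotProduct, binarySign_sum,
    smul_eq_mul, ← Finset.prod_mul_distrib]
  simp only [pauliMatrix_apply, ← Finset.prod_mul_distrib]
  rw [← Fintype.prod_sum (fun e c => singlePauli (p.1 e) (p.2 e) (a e) c *
    singlePauli (q.1 e) (q.2 e) c (b e))]
  refine Finset.prod_congr rfl fun e _ => ?_
  rw [← Matrix.mul_apply, singlePauli_mul]
  rfl

theorem pauliMatrix_zero : pauliMatrix (0 : Pauli E) = 1 := by
  ext a b
  rw [pauliMatrix_apply, Matrix.one_apply]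
  simp only [Prod.fst_zero, Prod.snd_zero, Pi.zero_apply, singlePauli, ZMod.val_zero, pow_zero,
    mul_one, Matrix.one_apply]
  rw [Fintype.prod_ite_zero]
  simp [funext_iff]

theorem pauliMatrix_mul_comm (p q : Pauli E) :
    pauliMatrix p * pauliMatrix q =
      binarySign (pauliComm p q) • (pauliMatrix q * pauliMatrix p) := by
  rw [pauliMatrix_mul, pauliMatrix_mul, smul_smul, pauliComm_eq_dotProduct, binarySign_add,
    dotProduct_comm q.2, mul_right_comm, binarySign_mul_self, one_mul, add_comm]

/-- Conjugation by a Pauli operator. -/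
noncomputable def pauliConj (p : Pauli E) (X : QubitOp E) : QubitOp E :=
  pauliMatrix p * X * (pauliMatrix p).conjTranspose

theorem pauliMatrix_mul_conjTranspose (p : Pauli E) :
    pauliMatrix p * (pauliMatrix p).conjTranspose = 1 := by
  rw [pauliMatrix_conjTranspose, Matrix.mul_smul, pauliMatrix_mul, smul_smul, Pauli.add_self,
    pauliMatrix_zero, dotProduct_comm, binarySign_mul_self, one_smul]

theorem smul_sandwich_sign {n : Type} [Fintype n] (t : ZMod 2) (A X : Matrix n n ℂ) :
    (binarySign t • A) * X * (binarySign t • A).conjTranspose = A * X * A.conjTranspose := by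
  rw [conjTranspose_smul, star_binarySign, Matrix.smul_mul, Matrix.smul_mul, Matrix.mul_smul,
    smul_smul, binarySign_mul_self, one_smul]

/-- The sign of a product cancels against that of its adjoint, so conjugation is a true action of
the additive group although `pauliMatrix` is multiplicative only up to sign. -/
theorem pauliConj_add (p q : Pauli E) (X : QubitOp E) :
    pauliConj (p + q) X = pauliConj p (pauliConj q X) := by
  have h := smul_sandwich_sign (p.2 ⬝ᵥ q.1) (pauliMatrix (p + q)) X
  rw [← pauliMatrix_mul] at h
  rw [pauliConj, ← h, pauliConj, pauliConj, conjTranspose_mul]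
  simp only [Matrix.mul_assoc]

theorem conjTranspose_sandwich (p : Pauli E) (X : QubitOp E) :
    (pauliMatrix p).conjTranspose * X * pauliMatrix p = pauliConj p X := by
  have h := smul_sandwich_sign (p.1 ⬝ᵥ p.2) (pauliMatrix p) X
  rw [← pauliMatrix_conjTranspose, conjTranspose_conjTranspose] at h
  exact h

theorem pauliConj_pauliMatrix (p q : Pauli E) :
    pauliConj p (pauliMatrix q) = binarySign (pauliComm p q) • pauliMatrix q := by
  rw [pauliConj, pauliMatrix_mul_comm, Matrix.smul_mul, Matrix.mul_assoc,
    pauliMatrix_mul_conjTranspose, Matrix.mul_one]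

theorem exists_pauliComm_eq_one {p : Pauli E} (hp : p ≠ 0) : ∃ q, pauliComm q p = 1 := by
  by_contra! h
  refine hp (Prod.ext (funext fun e => ?_) (funext fun e => ?_))
  · have := (ZMod.eq_zero_or_eq_one _).resolve_right (h (zOp (Pi.single e 1)))
    simpa [pauliComm_eq_dotProduct, zOp] using this
  · have := (ZMod.eq_zero_or_eq_one _).resolve_right (h (xOp (Pi.single e 1)))
    simpa [pauliComm_eq_dotProduct, xOp] using this

/-- Orthogonality of characters: translation by an operator that anticommutes with `q` reverses the
sign of the sum. -/
theorem sum_binarySign_pauliComm (q : Pauli E) :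
    ∑ p, binarySign (pauliComm p q) = if q = 0 then (Fintype.card (Pauli E) : ℂ) else 0 := by
  split_ifs with h
  · simp [h, pauliComm, binarySign_zero]
  · obtain ⟨r, hr⟩ := exists_pauliComm_eq_one h
    have h1 : ∑ p, binarySign (pauliComm p q) = ∑ p, binarySign (pauliComm (p + r) q) :=
      (Equiv.sum_comp (Equiv.addRight r) fun p => binarySign (pauliComm p q)).symm
    simp only [pauliComm_add_left, hr, binarySign_add, binarySign_one] at h1
    rw [← Finset.sum_mul] at h1
    linear_combination (1 / 2) * h1

/-! ## The projector on the code space -/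

variable (S : Submodule (ZMod 2) (Pauli E)) [Fintype S]

theorem sum_binarySign_pauliComm_stabiliser [DecidablePred (· ∈ pauliNormaliser S)]
    (p : Pauli E) : ∑ s : S, binarySign (pauliComm p (s : Pauli E)) =
      if p ∈ pauliNormaliser S then (Fintype.card S : ℂ) else 0 := by
  split_ifs with h
  · rw [Finset.sum_congr rfl fun s _ => by rw [h s s.2, binarySign_zero]]
    simp
  · rw [mem_pauliNormaliser] at h
    push Not at h
    obtain ⟨r, hr, hpr⟩ := h
    replace hpr := (ZMod.eq_zero_or_eq_one _).resolve_left hpr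
    have h1 : ∑ s : S, binarySign (pauliComm p (s : Pauli E)) =
        ∑ s : S, binarySign (pauliComm p (s + r : Pauli E)) :=
      (Equiv.sum_comp (Equiv.addRight (⟨r, hr⟩ : S))
        fun s => binarySign (pauliComm p (s : Pauli E))).symm
    simp only [pauliComm_add_right, hpr, binarySign_add, binarySign_one] at h1
    rw [← Finset.sum_mul] at h1
    linear_combination (1 / 2) * h1

/-- Sum the commutation signs over all pairs `(p, s)`: summing over `p` first leaves only `s = 0`,
summing over `s` first leaves only `p` in `N(S)`. -/
theorem card_stabiliser_mul_card_normaliser [DecidablePred (· ∈ pauliNormaliser S)] :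
    (Fintype.card S : ℂ) * (Finset.univ.filter (· ∈ pauliNormaliser S)).card =
      Fintype.card (Pauli E) := by
  have h := Finset.sum_comm (s := (Finset.univ : Finset (Pauli E))) (t := (Finset.univ : Finset S))
    (f := fun p s => binarySign (pauliComm p (s : Pauli E)))
  simp only [sum_binarySign_pauliComm, sum_binarySign_pauliComm_stabiliser] at h
  rw [Finset.sum_ite, Finset.sum_const_zero, add_zero, Finset.sum_const, nsmul_eq_mul,
    Finset.sum_eq_single (0 : S)] at h
  · rw [mul_comm, h]; simp
  · intro s _ hs
    simp [hs]
  · simp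

/-- The projector on the common `+1` eigenspace of a stabiliser group. -/
noncomputable def codeProjector : QubitOp E :=
  (Fintype.card S : ℂ)⁻¹ • ∑ s : S, pauliMatrix (s : Pauli E)

variable {S}

theorem codeProjector_mul_of_stabilised {ρ : QubitOp E}
    (h : ∀ s ∈ S, pauliMatrix s * ρ = ρ) : codeProjector S * ρ = ρ := by
  rw [codeProjector, Matrix.smul_mul, Matrix.sum_mul, Finset.sum_congr rfl fun (s : S) _ => h s.1 s.2,
    Finset.sum_const, Finset.card_univ, ← Nat.cast_smul_eq_nsmul ℂ, smul_smul,
    inv_mul_cancel₀ (Nat.cast_ne_zero.2 Fintype.card_ne_zero), one_smul]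

/-- The condition `hS` is stronger than commutation: the representatives `X ^ x * Z ^ z` of `S`
multiply without signs, so multiplication by one of them only permutes the summands of the
projector. Surface codes have this property because boundaries are orthogonal to coboundaries. -/
theorem pauliMatrix_mul_codeProjector (hS : ∀ s ∈ S, ∀ t ∈ S, s.2 ⬝ᵥ t.1 = 0) {s : Pauli E}
    (hs : s ∈ S) : pauliMatrix s * codeProjector S = codeProjector S := by
  rw [codeProjector, Matrix.mul_smul, Matrix.mul_sum]
  congr 1
  rw [← Equiv.sum_comp (Equiv.addLeft (⟨s, hs⟩ : S)) fun t => pauliMatrix (t : Pauli E)]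
  refine Finset.sum_congr rfl fun t _ => ?_
  rw [pauliMatrix_mul, hS s hs t t.2, binarySign_zero, one_smul]
  rfl

theorem codeProjector_mul_self (hS : ∀ s ∈ S, ∀ t ∈ S, s.2 ⬝ᵥ t.1 = 0) :
    codeProjector S * codeProjector S = codeProjector S :=
  codeProjector_mul_of_stabilised fun _ hs => pauliMatrix_mul_codeProjector hS hs

theorem codeProjector_conjTranspose (hS : ∀ s ∈ S, ∀ t ∈ S, s.2 ⬝ᵥ t.1 = 0) :
    (codeProjector S).conjTranspose = codeProjector S := by
  rw [codeProjector, conjTranspose_smul, conjTranspose_sum, star_inv₀, star_natCast]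
  congr 1
  refine Finset.sum_congr rfl fun s _ => ?_
  rw [pauliMatrix_conjTranspose, dotProduct_comm, hS s s.2 s s.2, binarySign_zero, one_smul]

theorem codeProjector_mul_pauliMatrix (hS : ∀ s ∈ S, ∀ t ∈ S, s.2 ⬝ᵥ t.1 = 0) {s : Pauli E}
    (hs : s ∈ S) : codeProjector S * pauliMatrix s = codeProjector S := by
  have h := congrArg conjTranspose (pauliMatrix_mul_codeProjector hS hs)
  rwa [conjTranspose_mul, codeProjector_conjTranspose hS, pauliMatrix_conjTranspose,
    dotProduct_comm, hS s hs s hs, binarySign_zero, one_smul] at h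

theorem pauliConj_codeProjector {p : Pauli E} (hp : p ∈ pauliNormaliser S) :
    pauliConj p (codeProjector S) = codeProjector S := by
  rw [pauliConj, codeProjector, Matrix.mul_smul, Matrix.smul_mul, Matrix.mul_sum, Matrix.sum_mul]
  congr 1
  refine Finset.sum_congr rfl fun s _ => ?_
  have := pauliConj_pauliMatrix p (s : Pauli E)
  rwa [hp s s.2, binarySign_zero, one_smul] at this

/-- Completeness of the syndrome projectors, each counted once for every Pauli operator of its
syndrome: averaging the signs over `p` kills all stabilisers except the identity. -/
theorem sum_pauliConj_codeProjector :
    ∑ p, pauliConj p (codeProjector S) =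
      ((Fintype.card (Pauli E) : ℂ) / Fintype.card S) • (1 : QubitOp E) := by
  have h : ∀ p : Pauli E, pauliConj p (codeProjector S) =
      (Fintype.card S : ℂ)⁻¹ • ∑ s : S, binarySign (pauliComm p (s : Pauli E)) •
        pauliMatrix (s : Pauli E) := by
    intro p
    rw [pauliConj, codeProjector, Matrix.mul_smul, Matrix.smul_mul, Matrix.mul_sum,
      Matrix.sum_mul]
    congr 1
    exact Finset.sum_congr rfl fun s _ => pauliConj_pauliMatrix p s
  rw [Finset.sum_congr rfl fun p _ => h p, ← Finset.smul_sum, Finset.sum_comm]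
  simp only [← Finset.sum_smul, sum_binarySign_pauliComm]
  rw [Finset.sum_eq_single (0 : S)]
  · simp [pauliMatrix_zero, smul_smul, div_eq_inv_mul]
  · intro s _ hs
    simp [hs]
  · simp

theorem codeProjector_mul_pauliMatrix_mul_of_mem {ρ : QubitOp E}
    (h : ∀ s ∈ S, pauliMatrix s * ρ = ρ) {p : Pauli E} (hp : p ∈ pauliNormaliser S) :
    codeProjector S * pauliMatrix p * ρ = pauliMatrix p * ρ := by
  have : codeProjector S * (pauliMatrix p * ρ) = pauliMatrix p * ρ := by
    refine codeProjector_mul_of_stabilised fun s hs => ?_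
    rw [← Matrix.mul_assoc, pauliMatrix_mul_comm, pauliComm_comm, hp s hs, binarySign_zero,
      one_smul, Matrix.mul_assoc, h s hs]
  rwa [← Matrix.mul_assoc] at this

/-- A stabiliser that anticommutes with `p` can be inserted in front of `ρ`, moved past `p` at the
cost of a sign, and absorbed by the projector. -/
theorem codeProjector_mul_pauliMatrix_mul_of_notMem (hS : ∀ s ∈ S, ∀ t ∈ S, s.2 ⬝ᵥ t.1 = 0)
    {ρ : QubitOp E} (h : ∀ s ∈ S, pauliMatrix s * ρ = ρ) {p : Pauli E}
    (hp : p ∉ pauliNormaliser S) : codeProjector S * pauliMatrix p * ρ = 0 := by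
  rw [mem_pauliNormaliser] at hp
  push Not at hp
  obtain ⟨s, hs, hps⟩ := hp
  replace hps := (ZMod.eq_zero_or_eq_one _).resolve_left hps
  have h1 : codeProjector S * pauliMatrix p * ρ = -(codeProjector S * pauliMatrix p * ρ) := by
    nth_rewrite 1 [← h s hs]
    rw [← Matrix.mul_assoc, Matrix.mul_assoc _ (pauliMatrix p), pauliMatrix_mul_comm, hps,
      binarySign_one, Matrix.mul_smul, ← Matrix.mul_assoc, codeProjector_mul_pauliMatrix hS hs,
      neg_one_smul, Matrix.neg_mul]
  ext a b
  exact self_eq_neg.1 (congrFun (congrFun h1 a) b)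

end

/-! ## Recovery from the transmuting conditions -/

section

variable {E : Type} [Fintype E] {S : Submodule (ZMod 2) (Pauli E)} {k : ℕ}

/-- For a syndrome that contains an error `e₀`, the correction is `e₀ + g` with `g` representing `π
e₀`. After another error `e` of this syndrome, what remains is `g + (e₀ + e)`, which represents `π
e₀ + (π e₀ + π e) = π e`. -/
theorem TransmutingConditions.exists_correction {A : LogicalIso S k} {errors : Set (Pauli E)}
    {M : Set (Pauli (Fin k))} (h : TransmutingConditions A errors M) :
    ∃ t : Pauli E → Pauli E, (∀ p, t p + p ∈ pauliNormaliser S) ∧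
      (∀ p q, p + q ∈ pauliNormaliser S → t p = t q) ∧ ∀ e ∈ errors, t e + e ∈ A.lift M := by
  obtain ⟨π, hπM, hπ⟩ := h
  have key : ∀ c : Pauli E ⧸ pauliNormaliser S, ∃ t : Pauli E,
      (Submodule.Quotient.mk t : Pauli E ⧸ pauliNormaliser S) = c ∧
        ∀ e ∈ errors, Submodule.Quotient.mk e = c → t + e ∈ A.lift M := by
    intro c
    by_cases hc : ∃ e ∈ errors, (Submodule.Quotient.mk e : Pauli E ⧸ pauliNormaliser S) = c
    · obtain ⟨e₀, he₀, rfl⟩ := hc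
      obtain ⟨g, hg⟩ : ∃ g, A.Represents g (π e₀) := by
        obtain ⟨g, hg⟩ := Submodule.Quotient.mk_surjective _ (A.toEquiv (π e₀))
        exact ⟨g, g, rfl, hg.symm⟩
      refine ⟨e₀ + g, ?_, fun e he hee => ⟨π e, hπM e he, ?_⟩⟩
      · rw [Submodule.Quotient.eq]
        simpa using hg.mem
      · have h1 := hπ e₀ he₀ e he (by
          rw [Submodule.Quotient.eq, sub_eq_add_neg, add_comm, Pauli.neg_eq] at hee
          rwa [Pauli.neg_eq])
        have h2 := hg.add h1
        rw [Pauli.neg_eq, Pauli.neg_eq, ← add_assoc, ← add_assoc, Pauli.add_self, zero_add,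
          add_comm g] at h2
        exact h2
    · obtain ⟨t, ht⟩ := Submodule.Quotient.mk_surjective _ c
      exact ⟨t, ht, fun e he hee => absurd ⟨e, he, hee⟩ hc⟩
  choose t ht1 ht2 using key
  refine ⟨fun p => t (Submodule.Quotient.mk p), fun p => ?_, fun p q hpq => ?_,
    fun e he => ht2 _ e he rfl⟩
  · have := (Submodule.Quotient.eq _).1 (ht1 (Submodule.Quotient.mk p))
    rwa [sub_eq_add_neg, Pauli.neg_eq] at this
  · refine congrArg t ((Submodule.Quotient.eq _).2 ?_)
    rwa [sub_eq_add_neg, Pauli.neg_eq]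

end

/-! ### Syndrome measurement followed by correction -/

section

variable {E : Type} [Fintype E] [DecidableEq E] {S : Submodule (ZMod 2) (Pauli E)} [Fintype S]

/-- Projection on the syndrome space of `t`, followed by the correction `t`. -/
noncomputable def recoveryOp (S : Submodule (ZMod 2) (Pauli E)) [Fintype S] (t : Pauli E) :
    QubitOp E :=
  codeProjector S * (pauliMatrix t).conjTranspose

theorem recoveryOp_conjTranspose_mul_self (hS : ∀ s ∈ S, ∀ t ∈ S, s.2 ⬝ᵥ t.1 = 0)
    (t : Pauli E) :
    (recoveryOp S t).conjTranspose * recoveryOp S t = pauliConj t (codeProjector S) := by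
  rw [recoveryOp, conjTranspose_mul, conjTranspose_conjTranspose, codeProjector_conjTranspose hS,
    pauliConj, Matrix.mul_assoc, ← Matrix.mul_assoc (codeProjector S), codeProjector_mul_self hS,
    Matrix.mul_assoc]

/-- The adjoint of `pauliMatrix t` differs from it by a sign that cancels, so correction and error
merge into one Pauli operator. -/
theorem recoveryOp_sandwich (t e : Pauli E) (ρ : QubitOp E) :
    recoveryOp S t * pauliConj e ρ * (recoveryOp S t).conjTranspose =
      codeProjector S * pauliMatrix (t + e) * ρ *
        (codeProjector S * pauliMatrix (t + e)).conjTranspose := by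
  have h2 := conjTranspose_sandwich t (pauliConj e ρ)
  rw [← pauliConj_add] at h2
  rw [show codeProjector S * pauliMatrix (t + e) * ρ *
      (codeProjector S * pauliMatrix (t + e)).conjTranspose =
      codeProjector S * pauliConj (t + e) ρ * (codeProjector S).conjTranspose by
        rw [conjTranspose_mul]; simp only [pauliConj, Matrix.mul_assoc],
    ← h2, recoveryOp, conjTranspose_mul, conjTranspose_conjTranspose]
  simp only [Matrix.mul_assoc]

theorem recoveryOp_sandwich_of_mem {ρ : QubitOp E} (hρ : ∀ s ∈ S, pauliMatrix s * ρ = ρ)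
    (hρ' : ρ.conjTranspose = ρ) {t e : Pauli E} (h : t + e ∈ pauliNormaliser S) :
    recoveryOp S t * pauliConj e ρ * (recoveryOp S t).conjTranspose = pauliConj (t + e) ρ := by
  have h5 := codeProjector_mul_pauliMatrix_mul_of_mem hρ h
  have h6 := congrArg conjTranspose h5
  rw [conjTranspose_mul, conjTranspose_mul _ ρ, hρ'] at h6
  rw [recoveryOp_sandwich, h5, Matrix.mul_assoc, h6, ← Matrix.mul_assoc]
  rfl

theorem recoveryOp_sandwich_of_notMem (hS : ∀ s ∈ S, ∀ t ∈ S, s.2 ⬝ᵥ t.1 = 0) {ρ : QubitOp E}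
    (hρ : ∀ s ∈ S, pauliMatrix s * ρ = ρ) {t e : Pauli E} (h : t + e ∉ pauliNormaliser S) :
    recoveryOp S t * pauliConj e ρ * (recoveryOp S t).conjTranspose = 0 := by
  rw [recoveryOp_sandwich, codeProjector_mul_pauliMatrix_mul_of_notMem hS hρ h, Matrix.zero_mul]

/-- The correction `t p` differs from `p` by an element of `N(S)`, which fixes the code projector,
so `t p` may be replaced by `p`. -/
theorem sum_recoveryOp_conjTranspose_mul_self (hS : ∀ s ∈ S, ∀ t ∈ S, s.2 ⬝ᵥ t.1 = 0)
    {t : Pauli E → Pauli E} (ht : ∀ p, t p + p ∈ pauliNormaliser S) :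
    ∑ p, (recoveryOp S (t p)).conjTranspose * recoveryOp S (t p) =
      ((Fintype.card (Pauli E) : ℂ) / Fintype.card S) • (1 : QubitOp E) := by
  rw [← sum_pauliConj_codeProjector]
  refine Finset.sum_congr rfl fun p _ => ?_
  have : t p = p + (t p + p) := by rw [add_left_comm, Pauli.add_self, add_zero]
  rw [recoveryOp_conjTranspose_mul_self hS, this, pauliConj_add, pauliConj_codeProjector (ht p)]

/-- Only the indices `p` with the syndrome of `e` contribute; they form a coset of `N(S)` and all
carry the same correction. -/
theorem sum_recoveryOp_sandwich [DecidablePred (· ∈ pauliNormaliser S)]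
    (hS : ∀ s ∈ S, ∀ t ∈ S, s.2 ⬝ᵥ t.1 = 0)
    {t : Pauli E → Pauli E} (ht : ∀ p, t p + p ∈ pauliNormaliser S)
    (htc : ∀ p q, p + q ∈ pauliNormaliser S → t p = t q)
    {ρ : QubitOp E} (hρ : ∀ s ∈ S, pauliMatrix s * ρ = ρ) (hρ' : ρ.conjTranspose = ρ)
    (e : Pauli E) :
    ∑ p, recoveryOp S (t p) * pauliConj e ρ * (recoveryOp S (t p)).conjTranspose =
      ((Finset.univ.filter (· ∈ pauliNormaliser S)).card : ℂ) • pauliConj (t e + e) ρ := by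
  have key : ∀ p, recoveryOp S (t p) * pauliConj e ρ * (recoveryOp S (t p)).conjTranspose =
      if p + e ∈ pauliNormaliser S then pauliConj (t e + e) ρ else 0 := by
    intro p
    have h3 : t p + p + (p + e) = t p + e := by
      rw [add_assoc, ← add_assoc p, Pauli.add_self, zero_add]
    have h4 := Submodule.add_mem_iff_right (pauliNormaliser S) (ht p) (y := p + e)
    rw [h3] at h4
    split_ifs with hpe
    · rw [recoveryOp_sandwich_of_mem hρ hρ' (h4.2 hpe), htc p e hpe]
    · exact recoveryOp_sandwich_of_notMem hS hρ fun h => hpe (h4.1 h)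
  rw [Finset.sum_congr rfl fun p _ => key p, ← Equiv.sum_comp (Equiv.addRight e)]
  simp only [Equiv.coe_addRight, add_assoc, Pauli.add_self, add_zero]
  rw [Finset.sum_ite, Finset.sum_const_zero, add_zero, Finset.sum_const,
    ← Nat.cast_smul_eq_nsmul ℂ]

theorem mul_pauliChannel_mul (K : QubitOp E) (r : Pauli E → ℝ) (ρ : QubitOp E) :
    K * pauliChannel r ρ * K.conjTranspose =
      ∑ e, (r e : ℂ) • (K * pauliConj e ρ * K.conjTranspose) := by
  simp only [pauliChannel, Matrix.mul_sum, Matrix.sum_mul, Matrix.mul_smul, Matrix.smul_mul]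
  rfl

theorem sum_smul_pauliConj_eq_pauliChannel (r : Pauli E → ℝ) (f : Pauli E → Pauli E)
    (ρ : QubitOp E) : ∑ e, (r e : ℂ) • pauliConj (f e) ρ =
      pauliChannel (fun p => ∑ e with f e = p, r e) ρ := by
  rw [← Finset.sum_fiberwise Finset.univ f, pauliChannel]
  refine Finset.sum_congr rfl fun p _ => ?_
  rw [Complex.ofReal_sum, Finset.sum_smul]
  refine Finset.sum_congr rfl fun e he => ?_
  rw [(Finset.mem_filter.1 he).2]
  rfl

end

section

variable {V E F : Type} [Fintype E] [DecidableEq E]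
  {D₁ : Matrix V E (ZMod 2)} {D₂ : Matrix E F (ZMod 2)}

theorem IsCodeState.stabilised {ρ : QubitOp E} (h : IsCodeState D₁ D₂ ρ)
    (hS : ∀ s ∈ surfaceStabiliser D₁ D₂, ∀ t ∈ surfaceStabiliser D₁ D₂, s.2 ⬝ᵥ t.1 = 0) :
    ∀ s ∈ surfaceStabiliser D₁ D₂, pauliMatrix s * ρ = ρ := by
  intro s hs
  induction hs using Submodule.span_induction with
  | mem g hg => exact h.2.2 g hg
  | zero => rw [pauliMatrix_zero, Matrix.one_mul]
  | add s t hs ht ihs iht =>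
    have := pauliMatrix_mul s t
    rw [hS s hs t ht, binarySign_zero, one_smul] at this
    rw [← this, Matrix.mul_assoc, iht, ihs]
  | smul a s hs ih =>
    rcases ZMod.eq_zero_or_eq_one a with rfl | rfl
    · rw [zero_smul, pauliMatrix_zero, Matrix.one_mul]
    · rwa [one_smul]

/-- The algebraic transmuting conditions suffice for a transmuting recovery operation. -/
theorem TransmutingConditions.isTransmutingCode {k : ℕ}
    {A : LogicalIso (surfaceStabiliser D₁ D₂) k} {errors : Set (Pauli E)}
    {M : Set (Pauli (Fin k))} (h : TransmutingConditions A errors M)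
    (hS : ∀ s ∈ surfaceStabiliser D₁ D₂, ∀ t ∈ surfaceStabiliser D₁ D₂, s.2 ⬝ᵥ t.1 = 0) :
    IsTransmutingCode D₁ D₂ A errors M := by
  classical
  obtain ⟨t, htN, htc, htM⟩ := h.exists_correction
  set S := surfaceStabiliser D₁ D₂
  let _ : Fintype S := Fintype.ofFinite S
  set nN := (Finset.univ.filter (· ∈ pauliNormaliser S)).card with hnN
  have hcard : (Fintype.card S : ℂ) * nN = Fintype.card (Pauli E) :=
    card_stabiliser_mul_card_normaliser S
  have hnN0 : 0 < nN := Finset.card_pos.2 ⟨0, by simp⟩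
  have hnN0' : (nN : ℂ) ≠ 0 := Nat.cast_ne_zero.2 hnN0.ne'
  have hS0 : (Fintype.card S : ℂ) ≠ 0 := Nat.cast_ne_zero.2 Fintype.card_ne_zero
  -- The Kraus operators are indexed by all Pauli operators rather than by syndromes, so each
  -- syndrome occurs `nN` times; `c` compensates for this.
  set c : ℂ := (((Real.sqrt (nN : ℝ))⁻¹ : ℝ) : ℂ) with hc
  have hcstar : star c = c := Complex.conj_ofReal _
  have hcc : c * c = (nN : ℂ)⁻¹ := by
    rw [hc, ← Complex.ofReal_mul, ← mul_inv, Real.mul_self_sqrt (Nat.cast_nonneg _)]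
    simp
  let K : Pauli E → QubitOp E := fun p => c • recoveryOp S (t p)
  have hK : ∀ p X, K p * X * (K p).conjTranspose =
      (nN : ℂ)⁻¹ • (recoveryOp S (t p) * X * (recoveryOp S (t p)).conjTranspose) := by
    intro p X
    rw [conjTranspose_smul, hcstar, Matrix.smul_mul, Matrix.smul_mul, Matrix.mul_smul,
      smul_smul, hcc]
  have hK1 : ∑ p, (K p).conjTranspose * K p = 1 := by
    have : ∀ p, (K p).conjTranspose * K p =
        (nN : ℂ)⁻¹ • ((recoveryOp S (t p)).conjTranspose * recoveryOp S (t p)) := by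
      intro p
      rw [conjTranspose_smul, hcstar, Matrix.smul_mul, Matrix.mul_smul, smul_smul, hcc]
    rw [Finset.sum_congr rfl fun p _ => this p, ← Finset.smul_sum,
      sum_recoveryOp_conjTranspose_mul_self hS htN, smul_smul, ← hcard,
      mul_div_cancel_left₀ _ hS0, inv_mul_cancel₀ hnN0', one_smul]
  refine ⟨Fintype.card (Pauli E), fun i => K ((Fintype.equivFin (Pauli E)).symm i), ?_, ?_⟩
  · rw [← hK1]
    exact Equiv.sum_comp (Fintype.equivFin (Pauli E)).symm fun p => (K p).conjTranspose * K p
  intro r hr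
  -- The residual errors are distributed as the push-forward of `r` under `e ↦ t e + e`.
  refine ⟨fun p => ∑ e with t e + e = p, r e, ⟨fun p => Finset.sum_nonneg fun e _ => hr.1 e, ?_,
    fun p hp => Finset.sum_eq_zero fun e he => hr.2.2 e fun he' => hp ?_⟩, fun ρ hρ => ?_⟩
  · rw [Finset.sum_fiberwise, hr.2.1]
  · rw [← (Finset.mem_filter.1 he).2]
    exact htM e he'
  rw [Equiv.sum_comp (Fintype.equivFin (Pauli E)).symm fun p =>
    K p * pauliChannel r ρ * (K p).conjTranspose]
  rw [Finset.sum_congr rfl fun p _ => mul_pauliChannel_mul (K p) r ρ, Finset.sum_comm,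
    ← sum_smul_pauliConj_eq_pauliChannel]
  refine Finset.sum_congr rfl fun e _ => ?_
  rw [← Finset.smul_sum, Finset.sum_congr rfl fun p _ => hK p _, ← Finset.smul_sum,
    sum_recoveryOp_sandwich hS htN htc (hρ.stabilised hS) hρ.1.1, ← hnN, smul_smul _ (nN : ℂ),
    inv_mul_cancel₀ hnN0', one_smul]

end

/-! ## Chains on the hexagonal lattice -/

section

variable {L : ℕ} [NeZero L]

/-- Parity of a column. -/
def colParity (L : ℕ) : ZMod (2 * L) →+* ZMod 2 := ZMod.castHom (dvd_mul_right 2 L) (ZMod 2)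

/-- Parity of a row. -/
def rowParity (hL : Even L) : ZMod L →+* ZMod 2 := ZMod.castHom hL.two_dvd (ZMod 2)

theorem rowParity_eq_val (hL : Even L) (j : ZMod L) : rowParity hL j = (j.val : ZMod 2) := by
  conv_lhs => rw [← ZMod.natCast_zmod_val j]
  rw [map_natCast]

theorem colParity_eq_val (i : ZMod (2 * L)) : colParity L i = (i.val : ZMod 2) := by
  conv_lhs => rw [← ZMod.natCast_zmod_val i]
  rw [map_natCast]

theorem colParity_hexColumn (hL : Even L) (k j : ZMod L) :
    colParity L (hexColumn L k j) = rowParity hL j := by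
  rw [hexColumn, map_natCast, rowParity_eq_val, Nat.cast_add, Nat.cast_mul, ZMod.natCast_mod]
  rw [show ((2 : ℕ) : ZMod 2) = 0 from rfl, zero_mul, zero_add]

theorem hexColumn_val (k j : ZMod L) : (hexColumn L k j).val = 2 * k.val + j.val % 2 := by
  have := ZMod.val_lt k
  rw [hexColumn, ZMod.val_natCast, Nat.mod_eq_of_lt (by omega)]

theorem hexColumn_inj {k k' j : ZMod L} : hexColumn L k j = hexColumn L k' j ↔ k = k' := by
  refine ⟨fun h => ?_, fun h => h ▸ rfl⟩
  have := congrArg ZMod.val h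
  rw [hexColumn_val, hexColumn_val] at this
  exact ZMod.val_injective L (by omega)

theorem exists_hexColumn (hL : Even L) {i : ZMod (2 * L)} {j : ZMod L}
    (h : colParity L i = rowParity hL j) : ∃ k, hexColumn L k j = i := by
  rw [colParity_eq_val, rowParity_eq_val, ZMod.natCast_eq_natCast_iff'] at h
  have := ZMod.val_lt i
  refine ⟨((i.val / 2 : ℕ) : ZMod L), ZMod.val_injective _ ?_⟩
  rw [hexColumn_val, ZMod.val_natCast, Nat.mod_eq_of_lt (by omega)]
  omega

/-- Evenness of `L` makes the parity of a row well defined modulo `L`, so arbitrary natural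
representatives may be used. -/
theorem hexColumn_natCast (hL : Even L) (a b : ℕ) :
    hexColumn L a b = ((2 * a + b % 2 : ℕ) : ZMod (2 * L)) := by
  rw [hexColumn, ZMod.natCast_eq_natCast_iff, ZMod.val_natCast, ZMod.val_natCast,
    Nat.mod_mod_of_dvd _ hL.two_dvd]
  exact Nat.ModEq.add_right _ (Nat.ModEq.mul_left' 2 (Nat.mod_modEq a L))

theorem hexColumn_add_one (hL : Even L) (k j : ZMod L) :
    hexColumn L (k + 1) j = hexColumn L k j + 2 := by
  have h := hexColumn_natCast hL (k.val + 1) j.val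
  have h' := hexColumn_natCast hL k.val j.val
  simp only [Nat.cast_add, Nat.cast_one, ZMod.natCast_zmod_val] at h h'
  rw [h, h']
  push_cast
  ring

theorem one_ne_zero_row (hL : Even L) : (1 : ZMod L) ≠ 0 := by
  intro h
  have := congrArg (rowParity hL) h
  rw [map_one, map_zero] at this
  exact one_ne_zero this

theorem one_ne_zero_col : (1 : ZMod (2 * L)) ≠ 0 := by
  intro h
  have := congrArg (colParity L) h
  rw [map_one, map_zero] at this
  exact one_ne_zero this

theorem ZMod.apply_eq_apply_zero {n : ℕ} {α : Type} {f : ZMod n → α} (h : ∀ i, f (i + 1) = f i)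
    (i : ZMod n) : f i = f 0 := by
  have hnat : ∀ a : ℕ, f a = f 0 := by
    intro a
    induction a with
    | zero => rw [Nat.cast_zero]
    | succ a ih => rw [Nat.cast_succ, h, ih]
  have hint : ∀ a : ℕ, f (-(a : ZMod n)) = f 0 := by
    intro a
    induction a with
    | zero => rw [Nat.cast_zero, neg_zero]
    | succ a ih => rw [← ih, ← h, Nat.cast_succ]; congr 1; ring
  obtain ⟨a, rfl⟩ := ZMod.intCast_surjective i
  obtain ⟨b, rfl | rfl⟩ := a.eq_nat_or_neg
  · exact_mod_cast hnat b
  · rw [Int.cast_neg, Int.cast_natCast]; exact hint b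

theorem hexEnds_ne (hL : Even L) (e : HexEdge L) : (hexEnds L e).1 ≠ (hexEnds L e).2 := by
  rcases e with ⟨i, j⟩ | ⟨k, j⟩
  · intro h
    have := congrArg Prod.fst h
    exact one_ne_zero_col (left_eq_add.1 this)
  · intro h
    have := congrArg Prod.snd h
    exact one_ne_zero_row hL (left_eq_add.1 this)

theorem hexD₁_col (hL : Even L) (e : HexEdge L) (v : HexVertex L) :
    hexD₁ L v e = Pi.single (M := fun _ => ZMod 2) (hexEnds L e).1 1 v +
      Pi.single (M := fun _ => ZMod 2) (hexEnds L e).2 1 v := by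
  have h := hexEnds_ne hL e
  simp only [hexD₁, Matrix.of_apply, Pi.single_apply]
  split_ifs <;> simp_all

/-- The indicator of the face between rows `j` and `j + 1` whose left column is `c`. -/
def faceIndicator (c : ZMod (2 * L)) (j : ZMod L) : HexFace L → ZMod 2 :=
  fun f => if hexColumn L f.1 f.2 = c ∧ f.2 = j then 1 else 0

theorem faceIndicator_hexColumn (k j : ZMod L) :
    faceIndicator (hexColumn L k j) j = Pi.single (k, j) 1 := by
  ext ⟨k', j'⟩
  simp only [faceIndicator, Pi.single_apply, Prod.mk.injEq]
  refine if_congr ⟨?_, ?_⟩ rfl rfl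
  · rintro ⟨h, rfl⟩
    exact ⟨hexColumn_inj.1 h, rfl⟩
  · rintro ⟨rfl, rfl⟩
    exact ⟨rfl, rfl⟩

theorem ite_or_add {p q r : Prop} [Decidable p] [Decidable q] [Decidable r] (h : r ↔ p ∨ q)
    (hpq : ¬(p ∧ q)) : (if r then 1 else 0 : ZMod 2) = (if p then 1 else 0) + if q then 1 else 0 := by
  by_cases hp : p <;> by_cases hq : q <;> simp_all

/-- When the parities agree, a brick of row `j` starts at column `i`: the edge is the left half of
its floor and the right half of the ceiling of the brick below. In the coordinates (left column,
row), crossing the edge is the step `±(1, 1)`. -/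
theorem hexD₂_inl_of_eq (hL : Even L) {i : ZMod (2 * L)} {j : ZMod L}
    (h : colParity L i = rowParity hL j) :
    (fun f => hexD₂ L (Sum.inl (i, j)) f) = faceIndicator i j + faceIndicator (i - 1) (j - 1) := by
  ext ⟨k', j'⟩
  have hp := colParity_hexColumn hL k' j'
  simp only [hexD₂, Matrix.of_apply, hexSides, faceIndicator, Pi.add_apply, Finset.mem_insert,
    Finset.mem_singleton, Sum.inl.injEq, Prod.mk.injEq, reduceCtorEq, or_false]
  set c := hexColumn L k' j'
  have hne : (1 : ZMod 2) ≠ 0 := one_ne_zero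
  refine ite_or_add ?_ ?_
  · constructor
    · rintro (⟨rfl, rfl⟩ | ⟨rfl, rfl⟩ | ⟨rfl, rfl⟩ | ⟨rfl, rfl⟩)
      · exact Or.inl ⟨rfl, rfl⟩
      · rw [map_add, map_one, hp] at h
        exact absurd (add_eq_left.1 h) hne
      · rw [map_add, map_one, hp] at h
        exact absurd (left_eq_add.1 h) hne
      · exact Or.inr ⟨by ring, by ring⟩
    · rintro (⟨rfl, rfl⟩ | ⟨h1, rfl⟩)
      · exact Or.inl ⟨rfl, rfl⟩
      · exact Or.inr (Or.inr (Or.inr ⟨by rw [h1]; ring, by ring⟩))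
  · rintro ⟨⟨rfl, rfl⟩, -, h1⟩
    exact one_ne_zero_row hL (sub_eq_self.1 h1.symm)

/-- For the other parity the two halves are exchanged, and crossing the edge is the step `±(1, -1)`.
-/
theorem hexD₂_inl_of_ne (hL : Even L) {i : ZMod (2 * L)} {j : ZMod L}
    (h : colParity L i = rowParity hL j + 1) :
    (fun f => hexD₂ L (Sum.inl (i, j)) f) = faceIndicator (i - 1) j + faceIndicator i (j - 1) := by
  ext ⟨k', j'⟩
  have hp := colParity_hexColumn hL k' j'
  simp only [hexD₂, Matrix.of_apply, hexSides, faceIndicator, Pi.add_apply, Finset.mem_insert,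
    Finset.mem_singleton, Sum.inl.injEq, Prod.mk.injEq, reduceCtorEq, or_false]
  set c := hexColumn L k' j'
  have hne : (1 : ZMod 2) ≠ 0 := one_ne_zero
  refine ite_or_add ?_ ?_
  · constructor
    · rintro (⟨rfl, rfl⟩ | ⟨rfl, rfl⟩ | ⟨rfl, rfl⟩ | ⟨rfl, rfl⟩)
      · rw [hp] at h
        exact absurd (left_eq_add.1 h) hne
      · exact Or.inl ⟨by ring, rfl⟩
      · exact Or.inr ⟨by ring, by ring⟩
      · rw [map_add, map_add, map_one, map_one, hp, add_assoc] at h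
        exact absurd (add_left_cancel h) (by decide)
    · rintro (⟨h1, rfl⟩ | ⟨rfl, rfl⟩)
      · exact Or.inr (Or.inl ⟨by rw [h1]; ring, rfl⟩)
      · exact Or.inr (Or.inr (Or.inl ⟨by ring, by ring⟩))
  · rintro ⟨⟨_, rfl⟩, -, h1⟩
    exact one_ne_zero_row hL (sub_eq_self.1 h1.symm)

theorem hexD₂_inr (hL : Even L) (k j : ZMod L) :
    (fun f => hexD₂ L (Sum.inr (k, j)) f) =
      faceIndicator (hexColumn L k j) j + faceIndicator (hexColumn L k j - 2) j := by
  have h2 : hexColumn L k j - 2 = hexColumn L (k - 1) j := by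
    rw [sub_eq_iff_eq_add, ← hexColumn_add_one hL, sub_add_cancel]
  rw [h2, faceIndicator_hexColumn, faceIndicator_hexColumn]
  ext ⟨k', j'⟩
  simp only [hexD₂, Matrix.of_apply, hexSides, Pi.add_apply, Finset.mem_insert, Pi.single_apply,
    Finset.mem_singleton, Sum.inr.injEq, Prod.mk.injEq, reduceCtorEq, false_or]
  refine ite_or_add ?_ ?_
  · constructor
    · rintro (⟨rfl, rfl⟩ | ⟨rfl, rfl⟩)
      · exact Or.inl ⟨rfl, rfl⟩
      · exact Or.inr ⟨by ring, rfl⟩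
    · rintro (⟨rfl, rfl⟩ | ⟨rfl, rfl⟩)
      · exact Or.inl ⟨rfl, rfl⟩
      · exact Or.inr ⟨by ring, rfl⟩
  · rintro ⟨⟨rfl, rfl⟩, h1, -⟩
    exact one_ne_zero_row hL (sub_eq_self.1 h1.symm)

/-- The coboundary of a single edge. -/
theorem hexD₂_transpose_mulVec_single (e : HexEdge L) :
    (hexD₂ L).transpose *ᵥ Pi.single e 1 = fun f => hexD₂ L e f := by
  ext f
  simp

theorem hexD₁_mulVec_single (hL : Even L) (e : HexEdge L) :
    hexD₁ L *ᵥ Pi.single e 1 = Pi.single (hexEnds L e).1 1 + Pi.single (hexEnds L e).2 1 := by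
  ext v
  simp [hexD₁_col hL]

theorem sum_mul_single_of_injective {A B : Type} [Fintype A] [DecidableEq B] {g : A → B}
    (hg : Function.Injective g) (s : A → ZMod 2) (a : A) :
    ∑ x, s x * Pi.single (M := fun _ => ZMod 2) (g x) 1 (g a) = s a := by
  classical
  rw [Finset.sum_eq_single a]
  · simp
  · intro b _ hb
    rw [Pi.single_eq_of_ne fun h => hb (hg h).symm, mul_zero]
  · simp

theorem sum_mul_single_of_ne {A B : Type} [Fintype A] [DecidableEq B] {g : A → B}
    (s : A → ZMod 2) {b : B} (hb : ∀ x, g x ≠ b) :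
    ∑ x, s x * Pi.single (M := fun _ => ZMod 2) (g x) 1 b = 0 :=
  Finset.sum_eq_zero fun x _ => by rw [Pi.single_eq_of_ne fun h => hb x h.symm, mul_zero]

theorem hexD₁_mulVec (hL : Even L) (s : HexEdge L → ZMod 2) (i : ZMod (2 * L)) (j : ZMod L) :
    (hexD₁ L *ᵥ s) (i, j) = s (.inl (i, j)) + s (.inl (i - 1, j)) +
      (∑ p : ZMod L × ZMod L, s (.inr p) * Pi.single (M := fun _ => ZMod 2)
        ((hexColumn L p.1 p.2, p.2) : HexVertex L) 1 (i, j) +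
      ∑ p : ZMod L × ZMod L, s (.inr p) * Pi.single (M := fun _ => ZMod 2)
        ((hexColumn L p.1 p.2, p.2 + 1) : HexVertex L) 1 (i, j)) := by
  have h1 := sum_mul_single_of_injective (g := fun p : ZMod (2 * L) × ZMod L => p)
    Function.injective_id (fun p => s (.inl p)) (i, j)
  have h2 := sum_mul_single_of_injective (g := fun p : ZMod (2 * L) × ZMod L => (p.1 + 1, p.2))
    (fun p q h => by simpa [Prod.ext_iff] using h) (fun p => s (.inl p)) (i - 1, j)
  simp only [sub_add_cancel] at h2
  rw [← h1, ← h2]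
  simp only [Matrix.mulVec, dotProduct, Fintype.sum_sum_type, hexD₁_col hL,
    mul_comm _ (s _), mul_add, Finset.sum_add_distrib]
  exact add_add_add_comm _ _ _ _

theorem upEnd_injective :
    Function.Injective fun p : ZMod L × ZMod L => ((hexColumn L p.1 p.2, p.2) : HexVertex L) := by
  rintro ⟨k, j⟩ ⟨k', j'⟩ h
  obtain ⟨h1, h2⟩ := Prod.ext_iff.1 h
  obtain rfl : j = j' := h2
  obtain rfl : k = k' := hexColumn_inj.1 h1
  rfl

theorem downEnd_injective : Function.Injective
    fun p : ZMod L × ZMod L => ((hexColumn L p.1 p.2, p.2 + 1) : HexVertex L) := by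
  rintro ⟨k, j⟩ ⟨k', j'⟩ h
  obtain ⟨h1, h2⟩ := Prod.ext_iff.1 h
  obtain rfl : j = j' := add_right_cancel h2
  obtain rfl : k = k' := hexColumn_inj.1 h1
  rfl

/-- Every vertex has a single vertical edge, which goes up when the parities of column and row agree
and down otherwise; parity removes the other sum. -/
theorem hexD₁_mulVec_upEnd (hL : Even L) (s : HexEdge L → ZMod 2) (k j : ZMod L) :
    (hexD₁ L *ᵥ s) (hexColumn L k j, j) =
      s (.inl (hexColumn L k j, j)) + s (.inl (hexColumn L k j - 1, j)) + s (.inr (k, j)) := by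
  have h1 := sum_mul_single_of_injective upEnd_injective (fun p => s (.inr p)) (k, j)
  rw [hexD₁_mulVec hL, h1, sum_mul_single_of_ne, add_zero]
  rintro ⟨k', j'⟩ h
  obtain ⟨h1, h2⟩ := Prod.ext_iff.1 h
  have h3 := congrArg (colParity L) h1
  simp only at h2
  rw [colParity_hexColumn hL, colParity_hexColumn hL, ← h2, map_add, map_one] at h3
  exact one_ne_zero (left_eq_add.1 h3)

theorem hexD₁_mulVec_downEnd (hL : Even L) (s : HexEdge L → ZMod 2) (k j : ZMod L) :
    (hexD₁ L *ᵥ s) (hexColumn L k j, j + 1) =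
      s (.inl (hexColumn L k j, j + 1)) + s (.inl (hexColumn L k j - 1, j + 1)) +
        s (.inr (k, j)) := by
  have h1 := sum_mul_single_of_injective downEnd_injective (fun p => s (.inr p)) (k, j)
  rw [hexD₁_mulVec hL, h1, sum_mul_single_of_ne, zero_add]
  rintro ⟨k', j'⟩ h
  obtain ⟨h1, h2⟩ := Prod.ext_iff.1 h
  have h3 := congrArg (colParity L) h1
  simp only at h2
  rw [colParity_hexColumn hL, colParity_hexColumn hL, h2, map_add, map_one] at h3
  exact one_ne_zero (add_eq_left.1 h3)

theorem mem_cycles_hexD₁ (hL : Even L) {s : HexEdge L → ZMod 2} (h : ∀ k j,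
    s (.inl (hexColumn L k j, j)) + s (.inl (hexColumn L k j - 1, j)) + s (.inr (k, j)) = 0 ∧
    s (.inl (hexColumn L k j, j + 1)) + s (.inl (hexColumn L k j - 1, j + 1)) +
      s (.inr (k, j)) = 0) : s ∈ cycles (hexD₁ L) := by
  rw [LinearMap.mem_ker, mulVecLin_apply]
  ext ⟨i, j⟩
  rcases ZMod.eq_zero_or_eq_one (colParity L i - rowParity hL j) with hp | hp
  · obtain ⟨k, rfl⟩ := exists_hexColumn hL (sub_eq_zero.1 hp)
    rw [hexD₁_mulVec_upEnd hL, (h k j).1]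
    rfl
  · obtain ⟨k, hk⟩ := exists_hexColumn hL (i := i) (j := j - 1) (by
      rw [map_sub, map_one, sub_eq_add_neg _ (1 : ZMod 2), show (-1 : ZMod 2) = 1 from rfl, ← hp]
      ring)
    obtain ⟨j, rfl⟩ : ∃ j', j = j' + 1 := ⟨j - 1, by ring⟩
    rw [add_sub_cancel_right] at hk
    subst hk
    rw [hexD₁_mulVec_downEnd hL, (h k j).2]
    rfl

theorem hexD₂_transpose_mulVec (hL : Even L) (s : HexEdge L → ZMod 2) (k j : ZMod L) :
    ((hexD₂ L).transpose *ᵥ s) (k, j) =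
      s (.inl (hexColumn L k j, j)) + (s (.inl (hexColumn L k j + 1, j)) +
      (s (.inl (hexColumn L k j, j + 1)) + (s (.inl (hexColumn L k j + 1, j + 1)) +
      (s (.inr (k, j)) + s (.inr (k + 1, j)))))) := by
  have h1 := one_ne_zero_row hL
  have h2 := one_ne_zero_col (L := L)
  have : ((hexD₂ L).transpose *ᵥ s) (k, j) = ∑ e ∈ hexSides L (k, j), s e := by
    simp [Matrix.mulVec, dotProduct, hexD₂]
  rw [this, hexSides, Finset.sum_insert, Finset.sum_insert, Finset.sum_insert, Finset.sum_insert,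
    Finset.sum_insert, Finset.sum_singleton] <;> simp [h1, h2]

theorem mem_cocycles_hexD₂ (hL : Even L) {s : HexEdge L → ZMod 2} (h : ∀ k j,
    s (.inl (hexColumn L k j, j)) + (s (.inl (hexColumn L k j + 1, j)) +
      (s (.inl (hexColumn L k j, j + 1)) + (s (.inl (hexColumn L k j + 1, j + 1)) +
      (s (.inr (k, j)) + s (.inr (k + 1, j)))))) = 0) : s ∈ cocycles (hexD₂ L) := by
  rw [LinearMap.mem_ker, mulVecLin_apply]
  ext ⟨k, j⟩
  rw [hexD₂_transpose_mulVec hL, h]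
  rfl

/-! ### Straight cycles and cocycles -/

/-- The horizontal edges between the columns `i` and `i + 1`. -/
def colCut (i : ZMod (2 * L)) : HexEdge L → ZMod 2 :=
  Sum.elim (fun p => if p.1 = i then 1 else 0) (fun _ => 0)

/-- The vertical edges between the rows `j` and `j + 1`. -/
def rowCut (j : ZMod L) : HexEdge L → ZMod 2 :=
  Sum.elim (fun _ => 0) (fun p => if p.2 = j then 1 else 0)

/-- The horizontal edges of row `j`. -/
def rowLoop (j : ZMod L) : HexEdge L → ZMod 2 :=
  Sum.elim (fun p => if p.2 = j then 1 else 0) (fun _ => 0)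

/-- The loop that zigzags between the columns `i` and `i + 1`. -/
def zigzag (i : ZMod (2 * L)) : HexEdge L → ZMod 2 :=
  Sum.elim (fun p => if p.1 = i then 1 else 0)
    (fun p => if hexColumn L p.1 p.2 = i ∨ hexColumn L p.1 p.2 = i + 1 then 1 else 0)

theorem rowLoop_mem_cycles (hL : Even L) (j : ZMod L) : rowLoop j ∈ cycles (hexD₁ L) :=
  mem_cycles_hexD₁ hL fun k j' => by
    simp [rowLoop, CharTwo.add_self_eq_zero]

theorem zigzag_mem_cycles (hL : Even L) (i : ZMod (2 * L)) : zigzag i ∈ cycles (hexD₁ L) :=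
  mem_cycles_hexD₁ hL fun k j => by
    simp only [zigzag, Sum.elim_inl, Sum.elim_inr, sub_eq_iff_eq_add, and_self]
    have h := ite_or_add (p := hexColumn L k j = i) (q := hexColumn L k j = i + 1) Iff.rfl
      (by rintro ⟨rfl, h⟩; exact one_ne_zero_col (left_eq_add.1 h))
    rw [h, CharTwo.add_self_eq_zero]

theorem colCut_mem_cocycles (hL : Even L) (i : ZMod (2 * L)) : colCut i ∈ cocycles (hexD₂ L) :=
  mem_cocycles_hexD₂ hL fun k j => by
    simp only [colCut, Sum.elim_inl, Sum.elim_inr, add_zero]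
    generalize (if hexColumn L k j = i then 1 else 0 : ZMod 2) = a
    generalize (if hexColumn L k j + 1 = i then 1 else 0 : ZMod 2) = b
    revert a b; decide

theorem rowCut_mem_cocycles (hL : Even L) (j : ZMod L) : rowCut j ∈ cocycles (hexD₂ L) :=
  mem_cocycles_hexD₂ hL fun k j' => by
    simp [rowCut, CharTwo.add_self_eq_zero]

theorem hexLoop_zero : hexLoop L 0 = rowLoop 0 := rfl

/-- The vertical edges in the columns `0` and `1` are exactly those of index `0`, one in each row.
-/
theorem hexLoop_one : hexLoop L 1 = zigzag 0 := by
  ext e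
  rcases e with p | ⟨k, j⟩
  · rfl
  · simp only [hexLoop, zigzag, Matrix.cons_val_one, Matrix.cons_val_fin_one, Sum.elim_inr]
    refine if_congr ⟨?_, ?_⟩ rfl rfl
    · rintro rfl
      rw [hexColumn, ZMod.val_zero, mul_zero, zero_add, zero_add]
      rcases Nat.mod_two_eq_zero_or_one j.val with h | h <;> simp [h]
    · intro h
      have h1 : hexColumn L k j = hexColumn L 0 j := by
        have h0 : (hexColumn L k j).val ≤ 1 := by
          have : Fact (1 < 2 * L) := ⟨by have := NeZero.pos L; omega⟩
          rcases h with h | h <;> simp [h, ZMod.val_one]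
        apply ZMod.val_injective
        rw [hexColumn_val] at h0
        rw [hexColumn_val, hexColumn_val, ZMod.val_zero]
        omega
      exact hexColumn_inj.1 h1

theorem hexCoLoop_zero : hexCoLoop L 0 = colCut 0 := rfl

theorem hexCoLoop_one : hexCoLoop L 1 = rowCut 0 := rfl

theorem colCut_dotProduct (i : ZMod (2 * L)) (s : HexEdge L → ZMod 2) :
    colCut i ⬝ᵥ s = ∑ j, s (.inl (i, j)) := by
  simp [dotProduct, colCut, Fintype.sum_sum_type, Fintype.sum_prod_type_right]

theorem rowCut_dotProduct (j : ZMod L) (s : HexEdge L → ZMod 2) :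
    rowCut j ⬝ᵥ s = ∑ k, s (.inr (k, j)) := by
  simp [dotProduct, rowCut, Fintype.sum_sum_type, Fintype.sum_prod_type]

theorem natCast_self_eq_zero_of_even (hL : Even L) : (L : ZMod 2) = 0 :=
  (ZMod.natCast_eq_zero_iff_even).2 hL

theorem colCut_dotProduct_rowLoop (i : ZMod (2 * L)) (j : ZMod L) :
    colCut i ⬝ᵥ rowLoop j = 1 := by
  simp [colCut_dotProduct, rowLoop]

theorem rowCut_dotProduct_rowLoop (j j' : ZMod L) : rowCut j ⬝ᵥ rowLoop j' = 0 := by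
  simp [rowCut_dotProduct, rowLoop]

theorem colCut_dotProduct_zigzag (hL : Even L) (i i' : ZMod (2 * L)) :
    colCut i ⬝ᵥ zigzag i' = 0 := by
  have h : colCut i ⬝ᵥ zigzag i' = ∑ _j : ZMod L, if i = i' then 1 else 0 := colCut_dotProduct i _
  rw [h]
  simp only [Finset.sum_const, Finset.card_univ,
    ZMod.card, nsmul_eq_mul, natCast_self_eq_zero_of_even hL, zero_mul]

/-- Exactly one of the columns `i`, `i + 1` has the parity of row `j`, so the zigzag crosses the cut
in one edge. -/
theorem rowCut_dotProduct_zigzag (hL : Even L) (j : ZMod L) (i : ZMod (2 * L)) :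
    rowCut j ⬝ᵥ zigzag i = 1 := by
  simp only [rowCut_dotProduct, zigzag, Sum.elim_inr]
  rcases ZMod.eq_zero_or_eq_one (colParity L i - rowParity hL j) with hp | hp
  · obtain ⟨k, hk⟩ := exists_hexColumn hL (sub_eq_zero.1 hp)
    rw [Finset.sum_eq_single k]
    · simp [hk]
    · intro k' _ hk'
      rw [if_neg]
      rintro (h | h)
      · exact hk' (hexColumn_inj.1 (h.trans hk.symm))
      · have := congrArg (colParity L) h
        rw [map_add, map_one, sub_eq_zero.1 hp, colParity_hexColumn hL] at this
        exact one_ne_zero (left_eq_add.1 this)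
    · simp
  · obtain ⟨k, hk⟩ := exists_hexColumn hL (i := i + 1) (j := j) (by
      rw [sub_eq_iff_eq_add] at hp
      rw [map_add, map_one, hp, add_right_comm, CharTwo.add_self_eq_zero, zero_add])
    rw [Finset.sum_eq_single k]
    · simp [hk]
    · intro k' _ hk'
      rw [if_neg]
      rintro (h | h)
      · have := congrArg (colParity L) h
        rw [colParity_hexColumn hL] at this
        rw [this, sub_self] at hp
        exact zero_ne_one hp
      · exact hk' (hexColumn_inj.1 (h.trans hk.symm))
    · simp

end

/-! ### Homology and cohomology of the hexagonal lattice -/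

/-- The functionals `φ` map `K` onto a space of dimension `k` and vanish on `U`, which has
codimension `k` in `K`; hence `U` is their common kernel in `K`. -/
theorem mem_of_finrank_eq_add {E : Type} [Fintype E] {k : ℕ}
    {U K : Submodule (ZMod 2) (E → ZMod 2)} (hUK : U ≤ K)
    (hfin : Module.finrank (ZMod 2) K = Module.finrank (ZMod 2) U + k)
    (φ : Fin k → E → ZMod 2) (hU : ∀ u ∈ U, ∀ i, φ i ⬝ᵥ u = 0)
    (z : Fin k → E → ZMod 2) (hz : ∀ i, z i ∈ K)
    (hφz : ∀ i j, φ i ⬝ᵥ z j = if i = j then 1 else 0)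
    {c : E → ZMod 2} (hc : c ∈ K) (h : ∀ i, φ i ⬝ᵥ c = 0) : c ∈ U := by
  let f : K →ₗ[ZMod 2] (Fin k → ZMod 2) := (Matrix.of φ).mulVecLin.domRestrict K
  have hf : ∀ c : K, f c = fun i => φ i ⬝ᵥ (c : E → ZMod 2) := fun _ => rfl
  have hsurj : LinearMap.range f = ⊤ := by
    refine LinearMap.range_eq_top.2 fun a => ⟨∑ j, a j • ⟨z j, hz j⟩, ?_⟩
    rw [map_sum]
    ext i
    have h1 : ∀ j, f (a j • ⟨z j, hz j⟩) i = if i = j then a j else 0 := fun j => by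
      rw [map_smul, Pi.smul_apply, hf]
      simp only [hφz, smul_eq_mul, mul_ite, mul_one, mul_zero]
    rw [Finset.sum_apply, Finset.sum_congr rfl fun j _ => h1 j, Finset.sum_ite_eq,
      if_pos (Finset.mem_univ i)]
  have hle : U.submoduleOf K ≤ LinearMap.ker f := fun u hu => funext fun i => hU u hu i
  have h1 := LinearMap.finrank_range_add_finrank_ker f
  rw [hsurj, finrank_top, Module.finrank_fin_fun, hfin] at h1
  have h2 : Module.finrank (ZMod 2) (U.submoduleOf K) = Module.finrank (ZMod 2) U :=
    (Submodule.submoduleOfEquivOfLe hUK).finrank_eq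
  have heq := Submodule.eq_of_le_of_finrank_eq hle (by omega)
  have hmem : (⟨c, hc⟩ : K) ∈ LinearMap.ker f := funext fun i => h i
  rw [← heq] at hmem
  exact hmem

theorem finrank_ker_eq_one {A B : Type} [Fintype A] [Nonempty A]
    (f : (A → ZMod 2) →ₗ[ZMod 2] (B → ZMod 2)) (h1 : f 1 = 0)
    (h : ∀ g, f g = 0 → ∀ a b, g a = g b) : Module.finrank (ZMod 2) (LinearMap.ker f) = 1 := by
  have : LinearMap.ker f = Submodule.span (ZMod 2) {1} := by
    refine le_antisymm (fun g hg => ?_) ?_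
    · refine Submodule.mem_span_singleton.2 ⟨g (Classical.arbitrary A), ?_⟩
      ext a
      simp [h g hg a (Classical.arbitrary A)]
    · rw [Submodule.span_singleton_le_iff_mem]
      exact h1
  rw [this]
  exact finrank_span_singleton one_ne_zero

section

variable {L : ℕ} [NeZero L]

theorem hexD₁_transpose_mulVec (hL : Even L) (g : HexVertex L → ZMod 2) (e : HexEdge L) :
    ((hexD₁ L).transpose *ᵥ g) e = g (hexEnds L e).1 + g (hexEnds L e).2 := by
  simp [Matrix.mulVec, dotProduct, hexD₁_col hL, add_mul, Finset.sum_add_distrib, Pi.single_apply]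

theorem coboundaries_le_cocycles (hL : Even L) :
    coboundaries (hexD₁ L) ≤ cocycles (hexD₂ L) := by
  rintro _ ⟨g, rfl⟩
  refine mem_cocycles_hexD₂ hL fun k j => ?_
  simp only [mulVecLin_apply, hexD₁_transpose_mulVec hL, hexEnds, hexColumn_add_one hL]
  rw [add_assoc (hexColumn L k j), one_add_one_eq_two]
  generalize g (hexColumn L k j, j) = a
  generalize g (hexColumn L k j + 1, j) = b
  generalize g (hexColumn L k j + 2, j) = c
  generalize g (hexColumn L k j, j + 1) = a'
  generalize g (hexColumn L k j + 1, j + 1) = b'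
  generalize g (hexColumn L k j + 2, j + 1) = c'
  revert a b c a' b' c'
  decide

theorem boundaries_le_cycles (hL : Even L) : boundaries (hexD₂ L) ≤ cycles (hexD₁ L) := by
  intro z hz
  rw [LinearMap.mem_ker, mulVecLin_apply]
  ext v
  have h := cocycles_dotProduct_boundaries
    (coboundaries_le_cocycles hL ⟨Pi.single v 1, rfl⟩) hz
  rw [mulVecLin_apply, mulVec_transpose, ← dotProduct_mulVec] at h
  simpa using h

theorem hexD₂_mulVec_inl (hL : Even L) (g : HexFace L → ZMod 2) {k k' j : ZMod L}
    (h : hexColumn L k' (j - 1) = hexColumn L k j - 1) :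
    (hexD₂ L *ᵥ g) (.inl (hexColumn L k j, j)) = g (k, j) + g (k', j - 1) := by
  change (fun f => hexD₂ L (Sum.inl (hexColumn L k j, j)) f) ⬝ᵥ g = _
  rw [hexD₂_inl_of_eq hL (colParity_hexColumn hL k j), ← h, faceIndicator_hexColumn,
    faceIndicator_hexColumn, add_dotProduct, single_one_dotProduct, single_one_dotProduct]

theorem hexD₂_mulVec_inr (hL : Even L) (g : HexFace L → ZMod 2) (k j : ZMod L) :
    (hexD₂ L *ᵥ g) (.inr (k + 1, j)) = g (k + 1, j) + g (k, j) := by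
  change (fun f => hexD₂ L (Sum.inr (k + 1, j)) f) ⬝ᵥ g = _
  rw [hexD₂_inr hL, hexColumn_add_one hL k j, add_sub_cancel_right, ← hexColumn_add_one hL k j,
    faceIndicator_hexColumn, faceIndicator_hexColumn, add_dotProduct, single_one_dotProduct,
    single_one_dotProduct]

/-- The dual lattice is connected: a function in the kernel agrees on the two sides of every edge,
vertical edges link the faces of a row, and horizontal edges link neighbouring rows. -/
theorem finrank_ker_hexD₂ (hL : Even L) :
    Module.finrank (ZMod 2) (LinearMap.ker (hexD₂ L).mulVecLin) = 1 := by
  have hcol : ∀ k j : ZMod L, ∃ k', hexColumn L k' (j - 1) = hexColumn L k j - 1 := fun k j =>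
    exists_hexColumn hL (by rw [map_sub, map_sub, map_one, map_one, colParity_hexColumn hL])
  refine finrank_ker_eq_one _ ?_ fun g hg => ?_
  · ext e
    rw [mulVecLin_apply]
    rcases e with ⟨i, j⟩ | ⟨k, j⟩
    · rcases ZMod.eq_zero_or_eq_one (colParity L i - rowParity hL j) with hp | hp
      · obtain ⟨k, rfl⟩ := exists_hexColumn hL (sub_eq_zero.1 hp)
        obtain ⟨k', hk'⟩ := hcol k j
        rw [hexD₂_mulVec_inl hL 1 hk']
        rfl
      · change (fun f => hexD₂ L (Sum.inl (i, j)) f) ⬝ᵥ (1 : HexFace L → ZMod 2) = 0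
        rw [sub_eq_iff_eq_add, add_comm] at hp
        obtain ⟨k, hk⟩ := exists_hexColumn hL (i := i - 1) (j := j) (by rw [map_sub, hp]; simp)
        obtain ⟨k', hk'⟩ := exists_hexColumn hL (i := i) (j := j - 1) (by
          rw [map_sub, hp, map_one, sub_eq_add_neg]; rfl)
        rw [hexD₂_inl_of_ne hL hp, ← hk, ← hk', faceIndicator_hexColumn, faceIndicator_hexColumn,
          add_dotProduct, single_one_dotProduct, single_one_dotProduct]
        rfl
    · rw [← sub_add_cancel k 1, hexD₂_mulVec_inr hL]
      rfl
  · rw [mulVecLin_apply] at hg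
    have h1 : ∀ k j, g (k, j) = g (0, j) := fun k j => by
      refine ZMod.apply_eq_apply_zero (f := fun k => g (k, j)) (fun k => ?_) k
      have := congrFun hg (.inr (k + 1, j))
      rw [hexD₂_mulVec_inr hL] at this
      exact CharTwo.add_eq_zero.1 this
    have h2 : ∀ j, g (0, j) = g (0, 0) := fun j => by
      refine ZMod.apply_eq_apply_zero (f := fun j => g (0, j)) (fun j => ?_) j
      obtain ⟨k', hk'⟩ := hcol 0 (j + 1)
      have := congrFun hg (.inl (hexColumn L 0 (j + 1), j + 1))
      rw [hexD₂_mulVec_inl hL g hk', add_sub_cancel_right, h1 k'] at this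
      exact CharTwo.add_eq_zero.1 this
    rintro ⟨k, j⟩ ⟨k', j'⟩
    rw [h1, h2, h1 k', h2 j']

theorem finrank_ker_hexD₁_transpose (hL : Even L) :
    Module.finrank (ZMod 2) (LinearMap.ker (hexD₁ L).transpose.mulVecLin) = 1 := by
  refine finrank_ker_eq_one _ ?_ fun g hg => ?_
  · ext e
    rw [mulVecLin_apply, hexD₁_transpose_mulVec hL]
    rfl
  · rw [mulVecLin_apply] at hg
    have h0 : ∀ e, g (hexEnds L e).2 = g (hexEnds L e).1 := fun e => by
      have := congrFun hg e
      rw [hexD₁_transpose_mulVec hL] at this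
      exact (CharTwo.add_eq_zero.1 this).symm
    have h1 : ∀ i j, g (i, j) = g (0, j) := fun i j =>
      ZMod.apply_eq_apply_zero (f := fun i => g (i, j)) (fun i => h0 (.inl (i, j))) i
    have h2 : ∀ j, g (0, j) = g (0, 0) := fun j =>
      ZMod.apply_eq_apply_zero (f := fun j => g (0, j)) (fun j => by
        have := h0 (.inr (0, j))
        simp only [hexEnds] at this
        rwa [h1, h1 _ j] at this) j
    rintro ⟨i, j⟩ ⟨i', j'⟩
    rw [h1, h2, h1 i', h2 j']

theorem rank_hexD₂ (hL : Even L) : (hexD₂ L).rank + 1 = L * L := by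
  have h := LinearMap.finrank_range_add_finrank_ker (hexD₂ L).mulVecLin
  rw [finrank_ker_hexD₂ hL, Module.finrank_fintype_fun_eq_card] at h
  simpa [Matrix.rank, ZMod.card] using h

theorem rank_hexD₁ (hL : Even L) : (hexD₁ L).rank + 1 = 2 * L * L := by
  have h := LinearMap.finrank_range_add_finrank_ker (hexD₁ L).transpose.mulVecLin
  rw [finrank_ker_hexD₁_transpose hL, Module.finrank_fintype_fun_eq_card] at h
  rw [← Matrix.rank_transpose, Matrix.rank]
  simpa [ZMod.card] using h

/-- Rank and nullity with `3 L²` edges: `3 L² - (2 L² - 1) = (L² - 1) + 2`. -/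
theorem finrank_cycles_hexD₁ (hL : Even L) :
    Module.finrank (ZMod 2) (cycles (hexD₁ L)) =
      Module.finrank (ZMod 2) (boundaries (hexD₂ L)) + 2 := by
  have h := LinearMap.finrank_range_add_finrank_ker (hexD₁ L).mulVecLin
  rw [Module.finrank_fintype_fun_eq_card, Fintype.card_sum, Fintype.card_prod, Fintype.card_prod,
    ZMod.card, ZMod.card] at h
  have h1 := rank_hexD₁ hL
  have h2 := rank_hexD₂ hL
  rw [Matrix.rank] at h1 h2
  change Module.finrank (ZMod 2) (LinearMap.ker (hexD₁ L).mulVecLin) =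
    Module.finrank (ZMod 2) (LinearMap.range (hexD₂ L).mulVecLin) + 2
  rw [mul_assoc] at h h1
  omega

theorem finrank_cocycles_hexD₂ (hL : Even L) :
    Module.finrank (ZMod 2) (cocycles (hexD₂ L)) =
      Module.finrank (ZMod 2) (coboundaries (hexD₁ L)) + 2 := by
  have h := LinearMap.finrank_range_add_finrank_ker (hexD₂ L).transpose.mulVecLin
  rw [Module.finrank_fintype_fun_eq_card, Fintype.card_sum, Fintype.card_prod, Fintype.card_prod,
    ZMod.card, ZMod.card] at h
  have h1 := rank_hexD₁ hL
  have h2 := rank_hexD₂ hL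
  rw [← Matrix.rank_transpose, Matrix.rank] at h1 h2
  change Module.finrank (ZMod 2) (LinearMap.ker (hexD₂ L).transpose.mulVecLin) =
    Module.finrank (ZMod 2) (LinearMap.range (hexD₁ L).transpose.mulVecLin) + 2
  rw [mul_assoc] at h h1
  omega

theorem hexLoop_mem_cycles (hL : Even L) (i : Fin 2) : hexLoop L i ∈ cycles (hexD₁ L) := by
  fin_cases i
  · exact rowLoop_mem_cycles hL 0
  · exact (hexLoop_one (L := L)) ▸ zigzag_mem_cycles hL 0

theorem hexCoLoop_mem_cocycles (hL : Even L) (i : Fin 2) :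
    hexCoLoop L i ∈ cocycles (hexD₂ L) := by
  fin_cases i
  · exact colCut_mem_cocycles hL 0
  · exact rowCut_mem_cocycles hL 0

theorem hexCoLoop_dotProduct_hexLoop (hL : Even L) (i j : Fin 2) :
    hexCoLoop L i ⬝ᵥ hexLoop L j = if i = j then 1 else 0 := by
  fin_cases i <;> fin_cases j
  · exact colCut_dotProduct_rowLoop 0 0
  · exact (hexLoop_one (L := L)) ▸ colCut_dotProduct_zigzag hL 0 0
  · exact rowCut_dotProduct_rowLoop 0 0
  · exact (hexLoop_one (L := L)) ▸ rowCut_dotProduct_zigzag hL 0 0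

/-- The fundamental loops of the lattice and of its dual. -/
def hexDualLoops (hL : Even L) : DualLoops (hexD₁ L) (hexD₂ L) 2 where
  z i := ⟨hexLoop L i, hexLoop_mem_cycles hL i⟩
  x i := ⟨hexCoLoop L i, hexCoLoop_mem_cocycles hL i⟩
  pairing := hexCoLoop_dotProduct_hexLoop hL
  mem_boundaries _ hc h := mem_of_finrank_eq_add (boundaries_le_cycles hL)
    (finrank_cycles_hexD₁ hL) (hexCoLoop L)
    (fun _ hu i => cocycles_dotProduct_boundaries (hexCoLoop_mem_cocycles hL i) hu) (hexLoop L)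
    (hexLoop_mem_cycles hL) (hexCoLoop_dotProduct_hexLoop hL) hc h
  mem_coboundaries _ hc h := mem_of_finrank_eq_add (coboundaries_le_cocycles hL)
    (finrank_cocycles_hexD₂ hL) (hexLoop L)
    (fun u hu i => by
      rw [dotProduct_comm]
      exact coboundaries_dotProduct_cycles hu (hexLoop_mem_cycles hL i)) (hexCoLoop L)
    (hexCoLoop_mem_cocycles hL)
    (fun i j => by
      rw [dotProduct_comm, hexCoLoop_dotProduct_hexLoop hL]; exact if_congr eq_comm rfl rfl) hc
    (fun i => by rw [dotProduct_comm]; exact h i)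

theorem hexStabiliser_isotropic (hL : Even L) :
    ∀ s ∈ hexStabiliser L, ∀ t ∈ hexStabiliser L, s.2 ⬝ᵥ t.1 = 0 := by
  intro s hs t ht
  rw [dotProduct_comm]
  exact cocycles_dotProduct_boundaries
    (coboundaries_le_cocycles hL (mem_surfaceStabiliser.1 ht).1) (mem_surfaceStabiliser.1 hs).2

theorem dotProduct_eq_hexLoop (hL : Even L) {x z : HexEdge L → ZMod 2}
    (hx : x ∈ cocycles (hexD₂ L)) (hz : z ∈ cycles (hexD₁ L)) :
    x ⬝ᵥ z = (x ⬝ᵥ hexLoop L 0) * (hexCoLoop L 0 ⬝ᵥ z) +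
      (x ⬝ᵥ hexLoop L 1) * (hexCoLoop L 1 ⬝ᵥ z) := by
  have := (hexDualLoops hL).dotProduct_eq hx hz
  rwa [Fin.sum_univ_two] at this

/-- All column cuts have the same intersection numbers with the two basic loops, so cycles cannot
distinguish them. The same argument makes row cuts, row loops and zigzags independent of their
position. -/
theorem colCut_dotProduct_cycle (hL : Even L) (i : ZMod (2 * L)) {z : HexEdge L → ZMod 2}
    (hz : z ∈ cycles (hexD₁ L)) : colCut i ⬝ᵥ z = hexCoLoop L 0 ⬝ᵥ z := by
  rw [dotProduct_eq_hexLoop hL (colCut_mem_cocycles hL i) hz, hexLoop_zero, hexLoop_one,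
    colCut_dotProduct_rowLoop, colCut_dotProduct_zigzag hL, one_mul, zero_mul, add_zero]

theorem rowCut_dotProduct_cycle (hL : Even L) (j : ZMod L) {z : HexEdge L → ZMod 2}
    (hz : z ∈ cycles (hexD₁ L)) : rowCut j ⬝ᵥ z = hexCoLoop L 1 ⬝ᵥ z := by
  rw [dotProduct_eq_hexLoop hL (rowCut_mem_cocycles hL j) hz, hexLoop_zero, hexLoop_one,
    rowCut_dotProduct_rowLoop, rowCut_dotProduct_zigzag hL, one_mul, zero_mul, zero_add]

theorem cocycle_dotProduct_rowLoop (hL : Even L) (j : ZMod L) {x : HexEdge L → ZMod 2}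
    (hx : x ∈ cocycles (hexD₂ L)) : x ⬝ᵥ rowLoop j = x ⬝ᵥ hexLoop L 0 := by
  rw [dotProduct_eq_hexLoop hL hx (rowLoop_mem_cycles hL j), hexCoLoop_zero, hexCoLoop_one,
    colCut_dotProduct_rowLoop, rowCut_dotProduct_rowLoop, mul_one, mul_zero, add_zero]

theorem cocycle_dotProduct_zigzag (hL : Even L) (i : ZMod (2 * L)) {x : HexEdge L → ZMod 2}
    (hx : x ∈ cocycles (hexD₂ L)) : x ⬝ᵥ zigzag i = x ⬝ᵥ hexLoop L 1 := by
  rw [dotProduct_eq_hexLoop hL hx (zigzag_mem_cycles hL i), hexCoLoop_zero, hexCoLoop_one,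
    colCut_dotProduct_zigzag hL, rowCut_dotProduct_zigzag hL, mul_one, mul_zero, zero_add]

/-! ### Lower bounds on weights -/

/-- Number of horizontal edges in a chain. -/
def horizontalWeight (s : HexEdge L → ZMod 2) : ℕ := hammingNorm fun p => s (.inl p)

/-- Number of vertical edges in a chain. -/
def verticalWeight (s : HexEdge L → ZMod 2) : ℕ := hammingNorm fun p => s (.inr p)

theorem hammingNorm_eq_sum {A : Type} [Fintype A] (s : A → ZMod 2) :
    hammingNorm s = ∑ a, if s a ≠ 0 then 1 else 0 := by
  rw [hammingNorm, Finset.card_filter]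

theorem hammingNorm_eq_add (s : HexEdge L → ZMod 2) :
    hammingNorm s = horizontalWeight s + verticalWeight s := by
  rw [horizontalWeight, verticalWeight, hammingNorm_eq_sum, hammingNorm_eq_sum, hammingNorm_eq_sum,
    Fintype.sum_sum_type]

/-- Double counting: each test chain shares an edge with `s`, while a horizontal edge lies in at
most `a` and a vertical edge in at most `b` of the test chains. -/
theorem card_le_of_dotProduct_ne_zero {ι : Type} [Fintype ι] (w : ι → HexEdge L → ZMod 2)
    (s : HexEdge L → ZMod 2) (h : ∀ i, w i ⬝ᵥ s ≠ 0) (a b : ℕ)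
    (ha : ∀ p, (Finset.univ.filter fun i => w i (.inl p) ≠ 0).card ≤ a)
    (hb : ∀ p, (Finset.univ.filter fun i => w i (.inr p) ≠ 0).card ≤ b) :
    Fintype.card ι ≤ a * horizontalWeight s + b * verticalWeight s := by
  have h1 : ∀ i, 1 ≤ ∑ e, (if w i e ≠ 0 then 1 else 0) * (if s e ≠ 0 then 1 else 0) := by
    intro i
    obtain ⟨e, -, he⟩ := Finset.exists_ne_zero_of_sum_ne_zero (h i)
    have h2 := Finset.single_le_sum (s := Finset.univ)
      (f := fun e => (if w i e ≠ 0 then 1 else 0) * (if s e ≠ 0 then 1 else 0))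
      (fun _ _ => Nat.zero_le _) (Finset.mem_univ e)
    simpa [left_ne_zero_of_mul he, right_ne_zero_of_mul he] using h2
  calc Fintype.card ι = ∑ _i : ι, 1 := by simp
    _ ≤ ∑ i, ∑ e, (if w i e ≠ 0 then 1 else 0) * (if s e ≠ 0 then 1 else 0) :=
        Finset.sum_le_sum fun i _ => h1 i
    _ = ∑ e, (Finset.univ.filter fun i => w i e ≠ 0).card * (if s e ≠ 0 then 1 else 0) := by
        rw [Finset.sum_comm]
        simp only [← Finset.sum_mul, Finset.card_filter]
    _ ≤ a * horizontalWeight s + b * verticalWeight s := by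
        rw [Fintype.sum_sum_type, horizontalWeight, verticalWeight, hammingNorm_eq_sum,
          hammingNorm_eq_sum, Finset.mul_sum, Finset.mul_sum]
        exact Nat.add_le_add (Finset.sum_le_sum fun p _ => Nat.mul_le_mul_right _ (ha p))
          (Finset.sum_le_sum fun p _ => Nat.mul_le_mul_right _ (hb p))

theorem le_horizontalWeight_of_cycle (hL : Even L) {z : HexEdge L → ZMod 2}
    (hz : z ∈ cycles (hexD₁ L)) (h : hexCoLoop L 0 ⬝ᵥ z ≠ 0) : 2 * L ≤ horizontalWeight z := by
  have := card_le_of_dotProduct_ne_zero (fun i => colCut (L := L) i) z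
    (fun i => by rwa [colCut_dotProduct_cycle hL i hz]) 1 0
    (fun p => by simp [colCut, Finset.filter_eq]) (fun p => by simp [colCut])
  simpa [ZMod.card] using this

theorem le_verticalWeight_of_cycle (hL : Even L) {z : HexEdge L → ZMod 2}
    (hz : z ∈ cycles (hexD₁ L)) (h : hexCoLoop L 1 ⬝ᵥ z ≠ 0) : L ≤ verticalWeight z := by
  have := card_le_of_dotProduct_ne_zero (fun i => rowCut (L := L) i) z
    (fun i => by rwa [rowCut_dotProduct_cycle hL i hz]) 0 1
    (fun p => by simp [rowCut]) (fun p => by simp [rowCut, Finset.filter_eq])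
  simpa [ZMod.card] using this

/-- In every row the cycle leaves upwards through some vertical edge. The lower end of that edge has
no other vertical edge, so the cycle must use a horizontal edge of the row. -/
theorem le_horizontalWeight_of_vertical_cycle (hL : Even L) {z : HexEdge L → ZMod 2}
    (hz : z ∈ cycles (hexD₁ L)) (h : hexCoLoop L 1 ⬝ᵥ z ≠ 0) : L ≤ horizontalWeight z := by
  have key : ∀ j, ∃ i, z (.inl (i, j)) ≠ 0 := by
    intro j
    have h1 : rowCut j ⬝ᵥ z ≠ 0 := by rwa [rowCut_dotProduct_cycle hL j hz]
    rw [rowCut_dotProduct] at h1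
    obtain ⟨k, -, hk⟩ := Finset.exists_ne_zero_of_sum_ne_zero h1
    by_contra! hcon
    have h2 := congrFun (LinearMap.mem_ker.1 hz) (hexColumn L k j, j)
    rw [mulVecLin_apply, hexD₁_mulVec_upEnd hL, hcon, hcon] at h2
    exact hk (by simpa using h2)
  choose i hi using key
  rw [horizontalWeight, hammingNorm]
  have := Finset.card_le_card_of_injOn (s := (Finset.univ : Finset (ZMod L)))
    (t := Finset.univ.filter fun p : ZMod (2 * L) × ZMod L => z (.inl p) ≠ 0)
    (fun j => (i j, j)) (fun j _ => by simp [hi j]) (fun j _ j' _ hjj => congrArg Prod.snd hjj)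
  simpa [ZMod.card] using this

theorem le_horizontalWeight_of_cocycle (hL : Even L) {x : HexEdge L → ZMod 2}
    (hx : x ∈ cocycles (hexD₂ L)) (h : x ⬝ᵥ hexLoop L 0 ≠ 0) : L ≤ horizontalWeight x := by
  have := card_le_of_dotProduct_ne_zero (fun i => rowLoop (L := L) i) x
    (fun i => by rwa [dotProduct_comm, cocycle_dotProduct_rowLoop hL i hx]) 1 0
    (fun p => by simp [rowLoop, Finset.filter_eq]) (fun p => by simp [rowLoop])
  simpa [ZMod.card] using this

/-- The test chains are the `2L` zigzags. A horizontal edge lies in one of them; a vertical edge in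
column `c` lies in those that start at `c` and at `c - 1`. -/
theorem le_weight_of_cocycle (hL : Even L) {x : HexEdge L → ZMod 2}
    (hx : x ∈ cocycles (hexD₂ L)) (h : x ⬝ᵥ hexLoop L 1 ≠ 0) :
    2 * L ≤ horizontalWeight x + 2 * verticalWeight x := by
  have := card_le_of_dotProduct_ne_zero (fun i => zigzag (L := L) i) x
    (fun i => by rwa [dotProduct_comm, cocycle_dotProduct_zigzag hL i hx]) 1 2
    (fun p => by simp [zigzag, Finset.filter_eq]) (fun p => by
      refine le_trans (Finset.card_le_card (t := {hexColumn L p.1 p.2, hexColumn L p.1 p.2 - 1})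
        fun i hi => ?_) Finset.card_le_two
      simp only [zigzag, Sum.elim_inr, Finset.mem_filter, Finset.mem_univ, true_and, ne_eq,
        ite_eq_right_iff, one_ne_zero, imp_false, not_not] at hi
      rcases hi with hi | hi <;> simp [hi])
  simpa [ZMod.card] using this

end

/-! ### Bases and minimal weights -/

namespace DualLoops

variable {V E F : Type} [Fintype V] [Fintype E] [Fintype F]
  {D₁ : Matrix V E (ZMod 2)} {D₂ : Matrix E F (ZMod 2)} {k : ℕ} (B : DualLoops D₁ D₂ k)

theorem homologyClass_eq_iff {c c' : cycles D₁} :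
    homologyClass D₁ D₂ c = homologyClass D₁ D₂ c' ↔
      ∀ i, (B.x i : E → ZMod 2) ⬝ᵥ (c : E → ZMod 2) =
        (B.x i : E → ZMod 2) ⬝ᵥ (c' : E → ZMod 2) := by
  have h1 : homologyClass D₁ D₂ c = homologyClass D₁ D₂ c' ↔
      (c : E → ZMod 2) - (c' : E → ZMod 2) ∈ boundaries D₂ :=
    Submodule.Quotient.eq ((boundaries D₂).submoduleOf (cycles D₁))
  rw [h1]
  constructor
  · intro h i
    have := cocycles_dotProduct_boundaries (B.x i).2 h
    rwa [dotProduct_sub, sub_eq_zero] at this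
  · intro h
    refine B.mem_boundaries _ (sub_mem c.2 c'.2) fun i => ?_
    rw [dotProduct_sub, h, sub_self]

theorem cohomologyClass_eq_iff {c c' : cocycles D₂} :
    cohomologyClass D₁ D₂ c = cohomologyClass D₁ D₂ c' ↔
      ∀ i, (c : E → ZMod 2) ⬝ᵥ (B.z i : E → ZMod 2) =
        (c' : E → ZMod 2) ⬝ᵥ (B.z i : E → ZMod 2) := by
  have h1 : cohomologyClass D₁ D₂ c = cohomologyClass D₁ D₂ c' ↔
      (c : E → ZMod 2) - (c' : E → ZMod 2) ∈ coboundaries D₁ :=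
    Submodule.Quotient.eq ((coboundaries D₁).submoduleOf (cocycles D₂))
  rw [h1]
  constructor
  · intro h i
    have := coboundaries_dotProduct_cycles h (B.z i).2
    rwa [sub_dotProduct, sub_eq_zero] at this
  · intro h
    refine B.mem_coboundaries _ (sub_mem c.2 c'.2) fun i => ?_
    rw [sub_dotProduct, h, sub_self]

theorem homologyClass_sum (g : Fin k → ZMod 2) :
    homologyClass D₁ D₂ (∑ i, g i • B.z i) = ∑ i, g i • homologyClass D₁ D₂ (B.z i) := by
  change Submodule.mkQ ((boundaries D₂).submoduleOf (cycles D₁)) _ = _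
  rw [map_sum]
  exact Finset.sum_congr rfl fun i _ => map_smul _ _ _

theorem cohomologyClass_sum (g : Fin k → ZMod 2) :
    cohomologyClass D₁ D₂ (∑ i, g i • B.x i) = ∑ i, g i • cohomologyClass D₁ D₂ (B.x i) := by
  change Submodule.mkQ ((coboundaries D₁).submoduleOf (cocycles D₂)) _ = _
  rw [map_sum]
  exact Finset.sum_congr rfl fun i _ => map_smul _ _ _

theorem coe_sum_z (g : Fin k → ZMod 2) :
    ((∑ i, g i • B.z i : cycles D₁) : E → ZMod 2) = ∑ i, g i • (B.z i : E → ZMod 2) := by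
  simp only [Submodule.coe_sum, Submodule.coe_smul]

theorem coe_sum_x (g : Fin k → ZMod 2) :
    ((∑ i, g i • B.x i : cocycles D₂) : E → ZMod 2) = ∑ i, g i • (B.x i : E → ZMod 2) := by
  simp only [Submodule.coe_sum, Submodule.coe_smul]

theorem linearIndependent_homologyClass :
    LinearIndependent (ZMod 2) fun i => homologyClass D₁ D₂ (B.z i) := by
  rw [Fintype.linearIndependent_iff]
  intro g hg i
  rw [← B.homologyClass_sum] at hg
  have := (B.homologyClass_eq_iff (c' := 0)).1 hg i
  rwa [coe_sum_z, x_dotProduct_sum_smul, Submodule.coe_zero, dotProduct_zero] at this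

theorem span_homologyClass :
    Submodule.span (ZMod 2) (Set.range fun i => homologyClass D₁ D₂ (B.z i)) = ⊤ := by
  refine Submodule.eq_top_iff'.2 fun q => ?_
  obtain ⟨c, rfl⟩ : ∃ c, homologyClass D₁ D₂ c = q := Submodule.Quotient.mk_surjective _ q
  rw [(B.homologyClass_eq_iff (c' := ∑ i, ((B.x i : E → ZMod 2) ⬝ᵥ (c : E → ZMod 2)) • B.z i)).2
    fun i => by rw [coe_sum_z, x_dotProduct_sum_smul], homologyClass_sum]
  exact Submodule.sum_mem _ fun i _ => Submodule.smul_mem _ _ (Submodule.subset_span ⟨i, rfl⟩)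

theorem linearIndependent_cohomologyClass :
    LinearIndependent (ZMod 2) fun i => cohomologyClass D₁ D₂ (B.x i) := by
  rw [Fintype.linearIndependent_iff]
  intro g hg i
  rw [← B.cohomologyClass_sum] at hg
  have := (B.cohomologyClass_eq_iff (c' := 0)).1 hg i
  rwa [coe_sum_x, sum_smul_x_dotProduct, Submodule.coe_zero, zero_dotProduct] at this

theorem span_cohomologyClass :
    Submodule.span (ZMod 2) (Set.range fun i => cohomologyClass D₁ D₂ (B.x i)) = ⊤ := by
  refine Submodule.eq_top_iff'.2 fun q => ?_
  obtain ⟨c, rfl⟩ : ∃ c, cohomologyClass D₁ D₂ c = q := Submodule.Quotient.mk_surjective _ q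
  rw [(B.cohomologyClass_eq_iff (c' := ∑ i, ((c : E → ZMod 2) ⬝ᵥ (B.z i : E → ZMod 2)) •
    B.x i)).2 fun i => by rw [coe_sum_x, sum_smul_x_dotProduct], cohomologyClass_sum]
  exact Submodule.sum_mem _ fun i _ => Submodule.smul_mem _ _ (Submodule.subset_span ⟨i, rfl⟩)

theorem homologyWeight_eq {c₀ : cycles D₁} {n : ℕ}
    (hex : ∃ c ∈ cycles D₁, (∀ i, (B.x i : E → ZMod 2) ⬝ᵥ c =
      (B.x i : E → ZMod 2) ⬝ᵥ (c₀ : E → ZMod 2)) ∧ hammingNorm c ≤ n)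
    (hle : ∀ c ∈ cycles D₁, (∀ i, (B.x i : E → ZMod 2) ⬝ᵥ c =
      (B.x i : E → ZMod 2) ⬝ᵥ (c₀ : E → ZMod 2)) → n ≤ hammingNorm c) :
    homologyWeight (homologyClass D₁ D₂ c₀) = n := by
  obtain ⟨c, hc, hcc, hn⟩ := hex
  refine IsLeast.csInf_eq ⟨⟨⟨c, hc⟩, B.homologyClass_eq_iff.2 hcc, le_antisymm hn (hle c hc hcc)⟩,
    ?_⟩
  rintro _ ⟨c', hc', rfl⟩
  exact hle c' c'.2 (B.homologyClass_eq_iff.1 hc')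

theorem cohomologyWeight_eq {c₀ : cocycles D₂} {n : ℕ}
    (hex : ∃ c ∈ cocycles D₂, (∀ i, c ⬝ᵥ (B.z i : E → ZMod 2) =
      (c₀ : E → ZMod 2) ⬝ᵥ (B.z i : E → ZMod 2)) ∧ hammingNorm c ≤ n)
    (hle : ∀ c ∈ cocycles D₂, (∀ i, c ⬝ᵥ (B.z i : E → ZMod 2) =
      (c₀ : E → ZMod 2) ⬝ᵥ (B.z i : E → ZMod 2)) → n ≤ hammingNorm c) :
    cohomologyWeight (cohomologyClass D₁ D₂ c₀) = n := by
  obtain ⟨c, hc, hcc, hn⟩ := hex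
  refine IsLeast.csInf_eq ⟨⟨⟨c, hc⟩, B.cohomologyClass_eq_iff.2 hcc,
    le_antisymm hn (hle c hc hcc)⟩, ?_⟩
  rintro _ ⟨c', hc', rfl⟩
  exact hle c' c'.2 (B.cohomologyClass_eq_iff.1 hc')

end DualLoops

/-! ### Explicit paths -/

theorem add_add_add_cancel_zmod_two {A : Type} (a b c : A → ZMod 2) :
    a + b + (b + c) = a + c := by
  ext i
  simp only [Pi.add_apply]
  generalize a i = a
  generalize b i = b
  generalize c i = c
  revert a b c
  decide

theorem mulVec_sum_range_telescope {A E : Type} [Fintype E] (D : Matrix A E (ZMod 2))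
    (s : ℕ → E → ZMod 2) (G : ℕ → A → ZMod 2) (n : ℕ)
    (h : ∀ t < n, D *ᵥ s t = G t + G (t + 1)) :
    D *ᵥ (∑ t ∈ Finset.range n, s t) = G 0 + G n := by
  induction n with
  | zero =>
    ext a
    simp [CharTwo.add_self_eq_zero]
  | succ n ih =>
    rw [Finset.sum_range_succ, mulVec_add, ih fun t ht => h t (by omega), h n (by omega),
      add_add_add_cancel_zmod_two]

/-- The chain of the first `n` edges of a sequence. -/
def pathChain {E : Type} [DecidableEq E] (n : ℕ) (e : ℕ → E) : E → ZMod 2 :=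
  ∑ t ∈ Finset.range n, Pi.single (e t) 1

theorem pathChain_succ {E : Type} [DecidableEq E] (n : ℕ) (e : ℕ → E) :
    pathChain (n + 1) e = pathChain n e + Pi.single (e n) 1 := Finset.sum_range_succ _ _

theorem hammingNorm_single_le {E : Type} [Fintype E] [DecidableEq E] (e : E) :
    hammingNorm (Pi.single e 1 : E → ZMod 2) ≤ 1 := by
  refine Finset.card_le_one.2 fun a ha b hb => ?_
  simp only [Finset.mem_filter, Finset.mem_univ, true_and, Pi.single_apply, ne_eq,
    ite_eq_right_iff, one_ne_zero, imp_false, not_not] at ha hb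
  rw [ha, hb]

/-- Repeated edges would cancel, so the length is only an upper bound. This suffices, since
intersection numbers supply the matching lower bounds where equality is needed. -/
theorem hammingNorm_pathChain_le {E : Type} [Fintype E] [DecidableEq E] (n : ℕ) (e : ℕ → E) :
    hammingNorm (pathChain n e) ≤ n := by
  induction n with
  | zero => simp [pathChain]
  | succ n ih =>
    rw [pathChain_succ]
    exact (hammingNorm_add_le _ _).trans (Nat.add_le_add ih (hammingNorm_single_le _))

theorem pathChain_dotProduct {E : Type} [Fintype E] [DecidableEq E] (n : ℕ) (e : ℕ → E)
    (s : E → ZMod 2) : pathChain n e ⬝ᵥ s = ∑ t ∈ Finset.range n, s (e t) := by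
  simp [pathChain, sum_dotProduct]

theorem ZMod.natCast_ne_zero_of_lt {n a : ℕ} (h0 : 0 < a) (h : a < n) : (a : ZMod n) ≠ 0 := by
  rw [Ne, ZMod.natCast_eq_zero_iff]
  exact fun hd => absurd (Nat.le_of_dvd h0 hd) (by omega)

section

variable {L : ℕ} [NeZero L]

theorem coboundary_pathChain (n : ℕ) (e : ℕ → HexEdge L) (G : ℕ → HexFace L → ZMod 2)
    (h : ∀ t < n, (fun f => hexD₂ L (e t) f) = G t + G (t + 1)) :
    (hexD₂ L).transpose *ᵥ pathChain n e = G 0 + G n :=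
  mulVec_sum_range_telescope _ _ _ _ fun t ht => by
    rw [hexD₂_transpose_mulVec_single, h t ht]

theorem coboundary_up_right (hL : Even L) (n : ℕ) :
    (hexD₂ L).transpose *ᵥ pathChain n (fun t => .inl ((t : ZMod (2 * L)) + 1, (t : ZMod L) + 1)) =
      faceIndicator 0 0 + faceIndicator n n := by
  rw [coboundary_pathChain n _ fun t => faceIndicator t t]
  · rw [Nat.cast_zero, Nat.cast_zero]
  · intro t _
    rw [hexD₂_inl_of_eq hL (by simp), add_comm, add_sub_cancel_right, add_sub_cancel_right,
      Nat.cast_succ, Nat.cast_succ]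

theorem coboundary_up_left (hL : Even L) (n : ℕ) :
    (hexD₂ L).transpose *ᵥ pathChain n (fun t => .inl (-(t : ZMod (2 * L)), (t : ZMod L) + 1)) =
      faceIndicator 0 0 + faceIndicator (-(n : ZMod (2 * L))) n := by
  rw [coboundary_pathChain n _ fun t => faceIndicator (-(t : ZMod (2 * L))) t]
  · rw [Nat.cast_zero, Nat.cast_zero, neg_zero]
  · intro t _
    rw [hexD₂_inl_of_ne hL, add_comm, add_sub_cancel_right, Nat.cast_succ, Nat.cast_succ,
      neg_add, sub_eq_add_neg]
    rw [map_neg, map_natCast, map_add, map_natCast, map_one, ZMod.neg_eq_self_mod_two, add_assoc,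
      CharTwo.add_self_eq_zero, add_zero]

theorem coboundary_down_right (hL : Even L) (n : ℕ) :
    (hexD₂ L).transpose *ᵥ pathChain n (fun t => .inl ((t : ZMod (2 * L)) + 1, -(t : ZMod L))) =
      faceIndicator 0 0 + faceIndicator n (-(n : ZMod L)) := by
  rw [coboundary_pathChain n _ fun t => faceIndicator t (-(t : ZMod L))]
  · rw [Nat.cast_zero, Nat.cast_zero, neg_zero]
  · intro t _
    rw [hexD₂_inl_of_ne hL, add_sub_cancel_right, Nat.cast_succ, Nat.cast_succ,
      neg_add, sub_eq_add_neg]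
    rw [map_neg, map_natCast, map_add, map_natCast, map_one, ZMod.neg_eq_self_mod_two]

theorem coboundary_down_left (hL : Even L) (n : ℕ) :
    (hexD₂ L).transpose *ᵥ pathChain n (fun t => .inl (-(t : ZMod (2 * L)), -(t : ZMod L))) =
      faceIndicator 0 0 + faceIndicator (-(n : ZMod (2 * L))) (-(n : ZMod L)) := by
  rw [coboundary_pathChain n _ fun t => faceIndicator (-(t : ZMod (2 * L))) (-(t : ZMod L))]
  · rw [Nat.cast_zero, Nat.cast_zero, neg_zero, neg_zero]
  · intro t _
    rw [hexD₂_inl_of_eq hL (by simp), Nat.cast_succ, Nat.cast_succ, neg_add, neg_add,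
      sub_eq_add_neg, sub_eq_add_neg]

/-- In row `m` the vertical edge of index `t + 1 + m / 2` stands in column `m + 2 (t + 1)`, the
right side of the face with left column `m + 2 t`. -/
theorem coboundary_right (hL : Even L) (m n : ℕ) :
    (hexD₂ L).transpose *ᵥ pathChain n
        (fun t => .inr (((t + 1 + m / 2 : ℕ) : ZMod L), ((m : ℕ) : ZMod L))) =
      faceIndicator (m : ZMod (2 * L)) m +
        faceIndicator ((m + 2 * n : ℕ) : ZMod (2 * L)) m := by
  rw [coboundary_pathChain n _ fun t => faceIndicator ((m + 2 * t : ℕ) : ZMod (2 * L)) m]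
  · rw [mul_zero, add_zero]
  · intro t _
    rw [hexD₂_inr hL, hexColumn_natCast hL,
      show 2 * (t + 1 + m / 2) + m % 2 = m + 2 * (t + 1) by omega, add_comm]
    congr 2
    push_cast
    ring

/-- The edge of index `m / 2 + m - t` stands in column `3 m - 2 t`, the left side of the current
face; `hn` keeps the truncated subtractions exact. -/
theorem coboundary_left (hL : Even L) (m n : ℕ) (hn : n ≤ m) :
    (hexD₂ L).transpose *ᵥ pathChain n
        (fun t => .inr (((m / 2 + m - t : ℕ) : ZMod L), ((m : ℕ) : ZMod L))) =
      faceIndicator ((3 * m : ℕ) : ZMod (2 * L)) m +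
        faceIndicator ((3 * m - 2 * n : ℕ) : ZMod (2 * L)) m := by
  rw [coboundary_pathChain n _ fun t => faceIndicator ((3 * m - 2 * t : ℕ) : ZMod (2 * L)) m]
  · rw [mul_zero, Nat.sub_zero]
  · intro t ht
    rw [hexD₂_inr hL, hexColumn_natCast hL,
      show 2 * (m / 2 + m - t) + m % 2 = 3 * m - 2 * t by omega]
    congr 2
    rw [show 3 * m - 2 * t = 3 * m - 2 * (t + 1) + 2 by omega]
    push_cast
    ring

theorem sum_range_ite_eq_zero {n : ℕ} {p : ℕ → Prop} [DecidablePred p] (h : ∀ t < n, ¬ p t) :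
    ∑ t ∈ Finset.range n, (if p t then 1 else 0 : ZMod 2) = 0 :=
  Finset.sum_eq_zero fun t ht => if_neg (h t (Finset.mem_range.1 ht))

theorem sum_range_ite_eq_one {n : ℕ} {p : ℕ → Prop} [DecidablePred p] (hn : 0 < n) (h0 : p 0)
    (h : ∀ t < n, t ≠ 0 → ¬ p t) :
    ∑ t ∈ Finset.range n, (if p t then 1 else 0 : ZMod 2) = 1 := by
  rw [Finset.sum_eq_single 0, if_pos h0]
  · exact fun t ht ht0 => if_neg (h t (Finset.mem_range.1 ht) ht0)
  · exact fun h => absurd (Finset.mem_range.2 hn) h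

/-- Four short paths of the dual lattice between two antipodal faces, one for each class. -/
theorem exists_antipodal_paths (hL : Even L) {m : ℕ} (hm : L = 2 * m) :
    ∃ P : Fin 4 → HexEdge L → ZMod 2,
      (∀ i j, P i + P j ∈ cocycles (hexD₂ L)) ∧
      (∀ i, P i ⬝ᵥ hexLoop L 0 = ![0, 0, 1, 1] i) ∧
      (∀ i, P i ⬝ᵥ hexLoop L 1 = ![0, 1, 0, 1] i) ∧
      (∀ i, hammingNorm (P i) ≤ ![m + (m + 1) / 2, m + m / 2, m + (m + 1) / 2, m + m / 2] i) := by
  have hm0 : 0 < m := by have := NeZero.pos L; omega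
  -- There are `2 m` rows and `4 m` columns, so `m` steps up or down end in the same row, while `m`
  -- steps to the left end in column `3 m`.
  have hrow : -(m : ZMod L) = m := by
    have : ((2 * m : ℕ) : ZMod L) = 0 := by rw [← hm, ZMod.natCast_self]
    rw [neg_eq_iff_add_eq_zero, ← two_mul]
    exact_mod_cast this
  have hcol : -(m : ZMod (2 * L)) = ((3 * m : ℕ) : ZMod (2 * L)) := by
    have : ((4 * m : ℕ) : ZMod (2 * L)) = 0 := by
      rw [show 4 * m = 2 * L by omega, ZMod.natCast_self]
    rw [neg_eq_iff_add_eq_zero, ← this]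
    push_cast
    ring
  -- The columns `m` and `3 m` are `m` hexagons apart. Paths from the left take `h` further steps
  -- and paths from the right the remaining `m / 2`, so all meet at column `m + 2 h`.
  set h := (m + 1) / 2 with hh
  have hhm : m / 2 = m - h := by omega
  set UR := pathChain m fun t => (.inl ((t : ZMod (2 * L)) + 1, (t : ZMod L) + 1) : HexEdge L)
    with hUR
  set UL := pathChain m fun t => (.inl (-(t : ZMod (2 * L)), (t : ZMod L) + 1) : HexEdge L)
    with hUL
  set DR := pathChain m fun t => (.inl ((t : ZMod (2 * L)) + 1, -(t : ZMod L)) : HexEdge L)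
    with hDR
  set DL := pathChain m fun t => (.inl (-(t : ZMod (2 * L)), -(t : ZMod L)) : HexEdge L)
    with hDL
  set HR := pathChain h fun t =>
    (.inr (((t + 1 + m / 2 : ℕ) : ZMod L), ((m : ℕ) : ZMod L)) : HexEdge L) with hHR
  set HL := pathChain (m / 2) fun t =>
    (.inr (((m / 2 + m - t : ℕ) : ZMod L), ((m : ℕ) : ZMod L)) : HexEdge L) with hHL
  have hδ : ∀ i, (hexD₂ L).transpose *ᵥ (![UR + HR, UL + HL, DR + HR, DL + HL] i) =
      faceIndicator 0 0 + faceIndicator ((m + 2 * h : ℕ) : ZMod (2 * L)) m := by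
    have hend : 3 * m - 2 * (m / 2) = m + 2 * h := by omega
    have hR := coboundary_right hL m h
    have hLft := coboundary_left hL m (m / 2) (by omega)
    rw [hend] at hLft
    intro i
    fin_cases i
    · change _ *ᵥ (UR + HR) = _
      rw [mulVec_add, coboundary_up_right hL, hR, add_add_add_cancel_zmod_two]
    · change _ *ᵥ (UL + HL) = _
      rw [mulVec_add, coboundary_up_left hL, hLft, hcol, add_add_add_cancel_zmod_two]
    · change _ *ᵥ (DR + HR) = _
      rw [mulVec_add, coboundary_down_right hL, hR, hrow, add_add_add_cancel_zmod_two]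
    · change _ *ᵥ (DL + HL) = _
      rw [mulVec_add, coboundary_down_left hL, hLft, hcol, hrow, add_add_add_cancel_zmod_two]
  -- Upward paths cross only the rows `1` to `m`; downward paths cross row `0` in their first step
  -- and never again. The same holds for the columns, with right and left in place of up and down.
  have hrow1 : ∀ t < m, ¬ (t : ZMod L) + 1 = 0 := fun t ht => by
    exact_mod_cast ZMod.natCast_ne_zero_of_lt (n := L) (a := t + 1) (by omega) (by omega)
  have hrow2 : ∀ t < m, t ≠ 0 → ¬ -(t : ZMod L) = 0 := fun t ht ht0 => by
    rw [neg_eq_zero]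
    exact ZMod.natCast_ne_zero_of_lt (by omega) (by omega)
  have hcol1 : ∀ t < m, ¬ (t : ZMod (2 * L)) + 1 = 0 := fun t ht => by
    exact_mod_cast ZMod.natCast_ne_zero_of_lt (n := 2 * L) (a := t + 1) (by omega) (by omega)
  have hcol2 : ∀ t < m, t ≠ 0 → ¬ -(t : ZMod (2 * L)) = 0 := fun t ht ht0 => by
    rw [neg_eq_zero]
    exact ZMod.natCast_ne_zero_of_lt (by omega) (by omega)
  have hHR0 : HR ⬝ᵥ hexLoop L 0 = 0 := by
    rw [hHR, pathChain_dotProduct]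
    exact Finset.sum_eq_zero fun t _ => rfl
  have hHL0 : HL ⬝ᵥ hexLoop L 0 = 0 := by
    rw [hHL, pathChain_dotProduct]
    exact Finset.sum_eq_zero fun t _ => rfl
  -- The vertical edges crossed have indices from `1` to `m` on the right-going part and from `m +
  -- 1` to `m + m / 2` on the left-going part, hence never `0`.
  have hHR1 : HR ⬝ᵥ hexLoop L 1 = 0 := by
    rw [hHR, pathChain_dotProduct]
    exact sum_range_ite_eq_zero fun t ht => ZMod.natCast_ne_zero_of_lt (by omega) (by omega)
  have hHL1 : HL ⬝ᵥ hexLoop L 1 = 0 := by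
    rw [hHL, pathChain_dotProduct]
    exact sum_range_ite_eq_zero fun t ht => ZMod.natCast_ne_zero_of_lt (by omega) (by omega)
  refine ⟨![UR + HR, UL + HL, DR + HR, DL + HL], fun i j => ?_, fun i => ?_, fun i => ?_,
    fun i => ?_⟩
  · rw [LinearMap.mem_ker, mulVecLin_apply, mulVec_add, hδ, hδ]
    ext f
    exact CharTwo.add_self_eq_zero (R := ZMod 2) _
  · fin_cases i
    · change (UR + HR) ⬝ᵥ _ = 0
      rw [add_dotProduct, hHR0, add_zero, hUR, pathChain_dotProduct]
      exact sum_range_ite_eq_zero hrow1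
    · change (UL + HL) ⬝ᵥ _ = 0
      rw [add_dotProduct, hHL0, add_zero, hUL, pathChain_dotProduct]
      exact sum_range_ite_eq_zero hrow1
    · change (DR + HR) ⬝ᵥ _ = 1
      rw [add_dotProduct, hHR0, add_zero, hDR, pathChain_dotProduct]
      exact sum_range_ite_eq_one hm0 (by simp) hrow2
    · change (DL + HL) ⬝ᵥ _ = 1
      rw [add_dotProduct, hHL0, add_zero, hDL, pathChain_dotProduct]
      exact sum_range_ite_eq_one hm0 (by simp) hrow2
  · fin_cases i
    · change (UR + HR) ⬝ᵥ _ = 0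
      rw [add_dotProduct, hHR1, add_zero, hUR, pathChain_dotProduct]
      exact sum_range_ite_eq_zero hcol1
    · change (UL + HL) ⬝ᵥ _ = 1
      rw [add_dotProduct, hHL1, add_zero, hUL, pathChain_dotProduct]
      exact sum_range_ite_eq_one hm0 (by simp) hcol2
    · change (DR + HR) ⬝ᵥ _ = 0
      rw [add_dotProduct, hHR1, add_zero, hDR, pathChain_dotProduct]
      exact sum_range_ite_eq_zero hcol1
    · change (DL + HL) ⬝ᵥ _ = 1
      rw [add_dotProduct, hHL1, add_zero, hDL, pathChain_dotProduct]
      exact sum_range_ite_eq_one hm0 (by simp) hcol2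
  · have key : ∀ (a b : ℕ) (e e' : ℕ → HexEdge L),
        hammingNorm (pathChain a e + pathChain b e') ≤ a + b := fun a b e e' =>
      (hammingNorm_add_le _ _).trans
        (Nat.add_le_add (hammingNorm_pathChain_le _ _) (hammingNorm_pathChain_le _ _))
    fin_cases i
    · exact key _ _ _ _
    · exact key _ _ _ _
    · exact key _ _ _ _
    · exact key _ _ _ _

/-- A short cycle that winds once in both directions. -/
theorem exists_diagonal_cycle (hL : Even L) :
    ∃ z ∈ cycles (hexD₁ L), (∀ i, hexCoLoop L i ⬝ᵥ z = 1) ∧ hammingNorm z ≤ 3 * L := by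
  -- The staircase `(t, t) → (t, t + 1) → (t + 1, t + 1)` uses `A` and `B`. After `L` rounds it has
  -- wound once vertically but only half way horizontally; `C` closes it along row `0`.
  set A := pathChain L fun t => (.inr (((t / 2 : ℕ) : ZMod L), ((t : ℕ) : ZMod L)) : HexEdge L)
    with hA
  set B := pathChain L fun t => (.inl (((t : ℕ) : ZMod (2 * L)), ((t + 1 : ℕ) : ZMod L)) :
    HexEdge L) with hB
  set C := pathChain L fun t => (.inl (((L + t : ℕ) : ZMod (2 * L)), 0) : HexEdge L) with hC
  have hL0 := NeZero.pos L
  refine ⟨A + B + C, ?_, fun i => ?_, ?_⟩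
  · have h1 : hexD₁ L *ᵥ (A + B) =
        Pi.single (((0 : ℕ) : ZMod (2 * L)), ((0 : ℕ) : ZMod L)) 1 +
          Pi.single (((L : ℕ) : ZMod (2 * L)), ((L : ℕ) : ZMod L)) 1 := by
      rw [hA, hB, pathChain, pathChain, ← Finset.sum_add_distrib]
      refine mulVec_sum_range_telescope _ _
        (fun t => Pi.single (((t : ℕ) : ZMod (2 * L)), ((t : ℕ) : ZMod L)) 1) L fun t _ => ?_
      rw [mulVec_add, hexD₁_mulVec_single hL, hexD₁_mulVec_single hL, hexEnds, hexEnds,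
        hexColumn_natCast hL, Nat.div_add_mod]
      simp only [Nat.cast_succ]
      rw [add_add_add_cancel_zmod_two]
    have h2 : hexD₁ L *ᵥ C =
        Pi.single (((L + 0 : ℕ) : ZMod (2 * L)), (0 : ZMod L)) 1 +
          Pi.single (((L + L : ℕ) : ZMod (2 * L)), (0 : ZMod L)) 1 := by
      refine mulVec_sum_range_telescope _ _
        (fun t => Pi.single (((L + t : ℕ) : ZMod (2 * L)), (0 : ZMod L)) 1) L fun t _ => ?_
      rw [hexD₁_mulVec_single hL, hexEnds, ← add_assoc L t 1, Nat.cast_succ]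
    rw [LinearMap.mem_ker, mulVecLin_apply, mulVec_add, h1, h2, ← two_mul L, ZMod.natCast_self,
      ZMod.natCast_self, add_zero, Nat.cast_zero, Nat.cast_zero, add_add_add_cancel_zmod_two]
    ext v
    exact CharTwo.add_self_eq_zero _
  · rw [dotProduct_comm, add_dotProduct, add_dotProduct, hA, hB, hC, pathChain_dotProduct,
      pathChain_dotProduct, pathChain_dotProduct]
    fin_cases i
    · have h1 : ∑ t ∈ Finset.range L,
          (if ((t : ℕ) : ZMod (2 * L)) = 0 then 1 else 0 : ZMod 2) = 1 :=
        sum_range_ite_eq_one hL0 Nat.cast_zero fun t ht ht0 =>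
          ZMod.natCast_ne_zero_of_lt (by omega) (by omega)
      have h2 : ∑ t ∈ Finset.range L,
          (if ((L + t : ℕ) : ZMod (2 * L)) = 0 then 1 else 0 : ZMod 2) = 0 :=
        sum_range_ite_eq_zero fun t ht => ZMod.natCast_ne_zero_of_lt (by omega) (by omega)
      have h3 : ∑ t ∈ Finset.range L, (0 : ZMod 2) = 0 := Finset.sum_const_zero
      exact (congrArg₂ (· + ·) (congrArg₂ (· + ·) h3 h1) h2).trans (by decide)
    · have h1 : ∑ t ∈ Finset.range L,
          (if ((t : ℕ) : ZMod L) = 0 then 1 else 0 : ZMod 2) = 1 :=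
        sum_range_ite_eq_one hL0 Nat.cast_zero fun t ht ht0 =>
          ZMod.natCast_ne_zero_of_lt (by omega) (by omega)
      have h3 : ∑ t ∈ Finset.range L, (0 : ZMod 2) = 0 := Finset.sum_const_zero
      exact (congrArg₂ (· + ·) (congrArg₂ (· + ·) h1 h3) h3).trans (by decide)
  · refine (hammingNorm_add_le _ _).trans ?_
    have h1 := (hammingNorm_add_le A B).trans (Nat.add_le_add (hammingNorm_pathChain_le _ _)
      (hammingNorm_pathChain_le _ _))
    have h2 : hammingNorm C ≤ L := hammingNorm_pathChain_le _ _
    omega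

end

/-! ### The toric code on the hexagonal lattice -/

section

variable {L : ℕ} [NeZero L]

theorem card_filter_fst_eq {A B : Type} [Fintype A] [Fintype B] [DecidableEq A] (a : A) :
    (Finset.univ.filter fun x : A × B => x.1 = a).card = Fintype.card B := by
  rw [Finset.card_filter, Fintype.sum_prod_type_right]
  simp

theorem card_filter_snd_eq {A B : Type} [Fintype A] [Fintype B] [DecidableEq B] (b : B) :
    (Finset.univ.filter fun x : A × B => x.2 = b).card = Fintype.card A := by
  rw [Finset.card_filter, Fintype.sum_prod_type]
  simp

theorem hammingNorm_hexLoop_le (i : Fin 2) : hammingNorm (hexLoop L i) ≤ 2 * L := by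
  rw [hammingNorm_eq_sum, Fintype.sum_sum_type]
  fin_cases i
  · simp [hexLoop, card_filter_snd_eq, ZMod.card]
  · simp [hexLoop, card_filter_fst_eq, ZMod.card, two_mul]

theorem hammingNorm_hexCoLoop_le (i : Fin 2) : hammingNorm (hexCoLoop L i) ≤ L := by
  rw [hammingNorm_eq_sum, Fintype.sum_sum_type]
  fin_cases i
  · simp [hexCoLoop, card_filter_fst_eq, ZMod.card]
  · simp [hexCoLoop, card_filter_snd_eq, ZMod.card]

theorem le_hammingNorm_of_cycle (hL : Even L) {z : HexEdge L → ZMod 2}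
    (hz : z ∈ cycles (hexD₁ L)) {i : Fin 2} (h : hexCoLoop L i ⬝ᵥ z ≠ 0) :
    2 * L ≤ hammingNorm z := by
  rw [hammingNorm_eq_add]
  fin_cases i
  · have := le_horizontalWeight_of_cycle hL hz h
    omega
  · have := le_horizontalWeight_of_vertical_cycle hL hz h
    have := le_verticalWeight_of_cycle hL hz h
    omega

theorem le_hammingNorm_of_diagonal_cycle (hL : Even L) {z : HexEdge L → ZMod 2}
    (hz : z ∈ cycles (hexD₁ L)) (h0 : hexCoLoop L 0 ⬝ᵥ z ≠ 0) (h1 : hexCoLoop L 1 ⬝ᵥ z ≠ 0) :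
    3 * L ≤ hammingNorm z := by
  rw [hammingNorm_eq_add]
  have := le_horizontalWeight_of_cycle hL hz h0
  have := le_verticalWeight_of_cycle hL hz h1
  omega

theorem le_hammingNorm_of_cocycle (hL : Even L) {x : HexEdge L → ZMod 2}
    (hx : x ∈ cocycles (hexD₂ L)) {i : Fin 2} (h : x ⬝ᵥ hexLoop L i ≠ 0) :
    L ≤ hammingNorm x := by
  rw [hammingNorm_eq_add]
  fin_cases i
  · have := le_horizontalWeight_of_cocycle hL hx h
    omega
  · have := le_weight_of_cocycle hL hx h
    omega

/-- The sum of the bound from row loops and the bound from zigzags. -/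
theorem le_hammingNorm_of_diagonal_cocycle (hL : Even L) {x : HexEdge L → ZMod 2}
    (hx : x ∈ cocycles (hexD₂ L)) (h0 : x ⬝ᵥ hexLoop L 0 ≠ 0) (h1 : x ⬝ᵥ hexLoop L 1 ≠ 0) :
    3 * L ≤ 2 * hammingNorm x := by
  rw [hammingNorm_eq_add]
  have := le_horizontalWeight_of_cocycle hL hx h0
  have := le_weight_of_cocycle hL hx h1
  omega

theorem represents_hexLogicalIso (hL : Even L) {p : Pauli (HexEdge L)} {a : Pauli (Fin 2)} :
    (hexDualLoops hL).logicalIso.Represents p a ↔ p.1 ∈ cocycles (hexD₂ L) ∧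
      p.2 ∈ cycles (hexD₁ L) ∧ (∀ i, p.1 ⬝ᵥ hexLoop L i = a.1 i) ∧
      ∀ i, hexCoLoop L i ⬝ᵥ p.2 = a.2 i := by
  rw [DualLoops.represents_iff, mem_pauliNormaliser_surfaceStabiliser, funext_iff, funext_iff,
    and_assoc]
  rfl

theorem mem_hexStabiliser_iff (hL : Even L) {p : Pauli (HexEdge L)} :
    p ∈ hexStabiliser L ↔ p.1 ∈ cocycles (hexD₂ L) ∧ p.2 ∈ cycles (hexD₁ L) ∧
      (∀ i, p.1 ⬝ᵥ hexLoop L i = 0) ∧ ∀ i, hexCoLoop L i ⬝ᵥ p.2 = 0 := by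
  rw [mem_surfaceStabiliser]
  constructor
  · rintro ⟨h1, h2⟩
    exact ⟨coboundaries_le_cocycles hL h1, boundaries_le_cycles hL h2,
      fun i => coboundaries_dotProduct_cycles h1 (hexLoop_mem_cycles hL i),
      fun i => cocycles_dotProduct_boundaries (hexCoLoop_mem_cocycles hL i) h2⟩
  · rintro ⟨h1, h2, h3, h4⟩
    exact ⟨(hexDualLoops hL).mem_coboundaries _ h1 h3, (hexDualLoops hL).mem_boundaries _ h2 h4⟩

theorem le_pauliWeight_of_notMem_hexStabiliser (hL : Even L) {p : Pauli (HexEdge L)}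
    (hp : p ∈ pauliNormaliser (hexStabiliser L)) (hpS : p ∉ hexStabiliser L) :
    L ≤ pauliWeight p := by
  obtain ⟨hx, hz⟩ := mem_pauliNormaliser_surfaceStabiliser.1 hp
  by_contra! hlt
  refine hpS ((mem_hexStabiliser_iff hL).2 ⟨hx, hz, fun i => ?_, fun i => ?_⟩)
  · by_contra h
    exact absurd ((le_hammingNorm_of_cocycle hL hx h).trans (hammingNorm_fst_le_pauliWeight p))
      (by omega)
  · by_contra h
    exact absurd ((le_hammingNorm_of_cycle hL hz h).trans (hammingNorm_snd_le_pauliWeight p))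
      (by omega)

/-- Below weight `3L/2` the `Z` part is trivial, since a nontrivial cycle has at least `2L` edges,
and the `X` part is not of the diagonal class; the three remaining classes are admissible. -/
theorem le_pauliWeight_of_notMem_lift (hL : Even L) {p : Pauli (HexEdge L)}
    (hp : p ∈ pauliNormaliser (hexStabiliser L))
    (hpM : p ∉ (hexDualLoops hL).logicalIso.lift singleBitFlips) :
    3 * L ≤ 2 * pauliWeight p := by
  obtain ⟨hx, hz⟩ := mem_pauliNormaliser_surfaceStabiliser.1 hp
  by_contra! hlt
  have h2 : ∀ i, hexCoLoop L i ⬝ᵥ p.2 = 0 := fun i => by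
    by_contra h
    exact absurd ((le_hammingNorm_of_cycle hL hz h).trans (hammingNorm_snd_le_pauliWeight p))
      (by omega)
  have h1 : ¬ (p.1 ⬝ᵥ hexLoop L 0 ≠ 0 ∧ p.1 ⬝ᵥ hexLoop L 1 ≠ 0) := fun h =>
    absurd ((le_hammingNorm_of_diagonal_cocycle hL hx h.1 h.2).trans
      (Nat.mul_le_mul_left 2 (hammingNorm_fst_le_pauliWeight p))) (by omega)
  have key : ∀ a : Pauli (Fin 2), a ∈ singleBitFlips → a.2 = 0 →
      p.1 ⬝ᵥ hexLoop L 0 = a.1 0 → p.1 ⬝ᵥ hexLoop L 1 = a.1 1 → False := by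
    intro a ha ha2 h3 h4
    refine hpM ⟨a, ha, (represents_hexLogicalIso hL).2 ⟨hx, hz, ?_, fun i => by
      rw [h2, ha2]; rfl⟩⟩
    intro i
    fin_cases i
    · exact h3
    · exact h4
  rcases ZMod.eq_zero_or_eq_one (p.1 ⬝ᵥ hexLoop L 0) with h3 | h3 <;>
    rcases ZMod.eq_zero_or_eq_one (p.1 ⬝ᵥ hexLoop L 1) with h4 | h4
  · exact key 0 (Or.inl rfl) rfl h3 h4
  · exact key (logicalX 1) (Or.inr (Or.inr rfl)) rfl h3 h4
  · exact key (logicalX 0) (Or.inr (Or.inl rfl)) rfl h3 h4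
  · exact h1 ⟨by rw [h3]; exact one_ne_zero, by rw [h4]; exact one_ne_zero⟩

theorem ncard_singleBitFlips_le : singleBitFlips.ncard ≤ 3 := by
  refine (Set.ncard_insert_le _ _).trans (Nat.succ_le_succ ?_)
  exact (Set.ncard_insert_le _ _).trans (Nat.succ_le_succ (Set.ncard_singleton _).le)

/-- Whatever the choice of the logical operators, errors of weight three quarters of `L` cannot be
transmuted. -/
theorem lt_of_transmutingConditions (hL : Even L) {w : ℕ} {A : LogicalIso (hexStabiliser L) 2}
    (h : TransmutingConditions A {p | pauliWeight p ≤ w} singleBitFlips) : 4 * w < 3 * L := by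
  obtain ⟨m, hm⟩ := hL.two_dvd
  obtain ⟨P, hP, hP0, hP1, hPw⟩ := exists_antipodal_paths hL hm
  by_contra! hw
  have hadd : ∀ i j, xOp (P i) + xOp (P j) = xOp (P i + P j) := fun i j => by simp [xOp]
  have hcard := h.card_le (Set.toFinite _) (n := 4) (fun i => xOp (P i)) (fun i => ?_)
    (fun i j => ?_) (fun i j hij hS => ?_)
  · exact absurd (hcard.trans ncard_singleBitFlips_le) (by norm_num)
  · refine (pauliWeight_xOp _).trans_le ((hPw i).trans ?_)
    fin_cases i <;> simp <;> omega
  · rw [hadd]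
    exact mem_pauliNormaliser_surfaceStabiliser.2 ⟨hP i j, zero_mem _⟩
  · rw [hadd, mem_hexStabiliser_iff hL] at hS
    have h0 := hS.2.2.1 0
    have h1 := hS.2.2.1 1
    simp only [xOp, add_dotProduct, hP0, hP1] at h0 h1
    -- The four paths realise all four pairs of crossing parities, so two different paths are
    -- separated by one of the loops.
    have key : ∀ i j : Fin 4, i ≠ j → (![0, 0, 1, 1] i + ![0, 0, 1, 1] j : ZMod 2) = 0 →
        (![0, 1, 0, 1] i + ![0, 1, 0, 1] j : ZMod 2) = 0 → False := by decide
    exact key i j hij h0 h1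

end

theorem mainTheorem9 (L : ℕ) [NeZero L] (hL : Even L) :
    ∃ (z : Fin 2 → cycles (hexD₁ L)) (x : Fin 2 → cocycles (hexD₂ L))
      (A : LogicalIso (hexStabiliser L) 2),
      -- the logical operators are given by the fundamental loops of the lattice and its dual
      (∀ i, (z i : HexEdge L → ZMod 2) = hexLoop L i) ∧
      (∀ i, (x i : HexEdge L → ZMod 2) = hexCoLoop L i) ∧
      (∀ i, A.Represents (zOp (z i)) (logicalZ i)) ∧
      (∀ i, A.Represents (xOp (x i)) (logicalX i)) ∧
      -- their classes are bases of homology and of cohomology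
      LinearIndependent (ZMod 2) (fun i => homologyClass (hexD₁ L) (hexD₂ L) (z i)) ∧
      Submodule.span (ZMod 2)
        (Set.range fun i => homologyClass (hexD₁ L) (hexD₂ L) (z i)) = ⊤ ∧
      LinearIndependent (ZMod 2) (fun i => cohomologyClass (hexD₁ L) (hexD₂ L) (x i)) ∧
      Submodule.span (ZMod 2)
        (Set.range fun i => cohomologyClass (hexD₁ L) (hexD₂ L) (x i)) = ⊤ ∧
      -- the minimal weights
      (∀ i, homologyWeight (homologyClass (hexD₁ L) (hexD₂ L) (z i)) = 2 * L) ∧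
      homologyWeight (homologyClass (hexD₁ L) (hexD₂ L) (z 0 + z 1)) = 3 * L ∧
      (∀ i, cohomologyWeight (cohomologyClass (hexD₁ L) (hexD₂ L) (x i)) = L) ∧
      (cohomologyWeight (cohomologyClass (hexD₁ L) (hexD₂ L) (x 0 + x 1)) : ℚ) = 3 / 2 * L ∧
      -- the distance of the code
      IsLeast {n : ℚ | ∃ p ∈ pauliNormaliser (hexStabiliser L),
        p ∉ hexStabiliser L ∧ (pauliWeight p : ℚ) = n} L ∧
      -- the distance when single logical bit flips are accepted
      IsLeast {n : ℚ | ∃ p ∈ pauliNormaliser (hexStabiliser L),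
        p ∉ A.lift singleBitFlips ∧ (pauliWeight p : ℚ) = n} (3 / 2 * L) ∧
      -- transmutation of all Pauli errors up to the corresponding weight, which is optimal
      TransmutingConditions A {p | pauliWeight p ≤ ⌊(3 / 4 : ℚ) * L - 1 / 2⌋₊} singleBitFlips ∧
      IsTransmutingCode (hexD₁ L) (hexD₂ L) A
        {p | pauliWeight p ≤ ⌊(3 / 4 : ℚ) * L - 1 / 2⌋₊} singleBitFlips ∧
      IsEffectiveDistance (hexStabiliser L) singleBitFlips
        (2 * ⌊(3 / 4 : ℚ) * L - 1 / 2⌋₊ + 1) := by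
  obtain ⟨m, hm⟩ := hL.two_dvd
  have hmq : (L : ℚ) = 2 * m := by exact_mod_cast hm
  have hL0 := NeZero.pos L
  set w := ⌊(3 / 4 : ℚ) * L - 1 / 2⌋₊ with hw
  have hw1 : 4 * w + 2 ≤ 3 * L := by
    have h : (w : ℚ) ≤ 3 / 4 * L - 1 / 2 := Nat.floor_le (by
      have : (1 : ℚ) ≤ L := by exact_mod_cast hL0
      linarith)
    have : ((4 * w + 2 : ℕ) : ℚ) ≤ (3 * L : ℕ) := by push_cast; linarith
    exact_mod_cast this
  have hw2 : 3 * L < 4 * w + 6 := by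
    have h : 3 / 4 * (L : ℚ) - 1 / 2 < w + 1 := Nat.lt_floor_add_one _
    have : ((3 * L : ℕ) : ℚ) < (4 * w + 6 : ℕ) := by push_cast; linarith
    exact_mod_cast this
  obtain ⟨P, hP, hP0, hP1, hPw⟩ := exists_antipodal_paths hL hm
  obtain ⟨c, hc, hcx, hcn⟩ := exists_diagonal_cycle hL
  -- The paths `P 0` and `P 3` differ in both parities, and their length bounds add up to `3 m =
  -- 3L/2`: together they form a minimal diagonal cocycle.
  have hd0 : (P 0 + P 3) ⬝ᵥ hexLoop L 0 = 1 := by rw [add_dotProduct, hP0, hP0]; decide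
  have hd1 : (P 0 + P 3) ⬝ᵥ hexLoop L 1 = 1 := by rw [add_dotProduct, hP1, hP1]; decide
  have hdn : hammingNorm (P 0 + P 3) ≤ 3 * m := by
    have h0 : hammingNorm (P 0) ≤ m + (m + 1) / 2 := hPw 0
    have h3 : hammingNorm (P 3) ≤ m + m / 2 := hPw 3
    have := hammingNorm_add_le (P 0) (P 3)
    omega
  have hpair := hexCoLoop_dotProduct_hexLoop hL
  set B := hexDualLoops hL with hB
  have hT : TransmutingConditions B.logicalIso {p | pauliWeight p ≤ w} singleBitFlips := by
    refine transmutingConditions_of_weight_le _ fun p hp hpw => ?_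
    by_contra hpM
    have := le_pauliWeight_of_notMem_lift hL hp hpM
    omega
  refine ⟨B.z, B.x, B.logicalIso, fun _ => rfl, fun _ => rfl, fun i => ?_, fun i => ?_,
    B.linearIndependent_homologyClass, B.span_homologyClass, B.linearIndependent_cohomologyClass,
    B.span_cohomologyClass, fun i => ?_, ?_, fun i => ?_, ?_, ⟨?_, ?_⟩, ⟨?_, ?_⟩, hT,
    hT.isTransmutingCode (hexStabiliser_isotropic hL), ?_⟩
  · refine (represents_hexLogicalIso hL).2 ⟨zero_mem _, (B.z i).2, fun j => zero_dotProduct _,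
      fun j => (hpair j i).trans ?_⟩
    simp [logicalZ, zOp, Pi.single_apply]
  · refine (represents_hexLogicalIso hL).2 ⟨(B.x i).2, zero_mem _, fun j => (hpair i j).trans ?_,
      fun j => dotProduct_zero _⟩
    simp [logicalX, xOp, Pi.single_apply, eq_comm]
  · refine B.homologyWeight_eq ⟨_, (B.z i).2, fun _ => rfl, hammingNorm_hexLoop_le i⟩
      fun c' hc' h => le_hammingNorm_of_cycle hL hc' (i := i) ?_
    exact (h i).trans_ne ((hpair i i).trans_ne (by simp))
  · have hz : ∀ i, hexCoLoop L i ⬝ᵥ (((B.z 0 + B.z 1 : cycles (hexD₁ L))) : HexEdge L → ZMod 2) =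
        1 := fun i => by
      change hexCoLoop L i ⬝ᵥ (hexLoop L 0 + hexLoop L 1) = 1
      rw [dotProduct_add, hpair, hpair]
      fin_cases i <;> rfl
    refine B.homologyWeight_eq ⟨c, hc, fun i => (hcx i).trans (hz i).symm, hcn⟩ fun c' hc' h => ?_
    exact le_hammingNorm_of_diagonal_cycle hL hc' (((h 0).trans (hz 0)).trans_ne one_ne_zero)
      (((h 1).trans (hz 1)).trans_ne one_ne_zero)
  · refine B.cohomologyWeight_eq ⟨_, (B.x i).2, fun _ => rfl, hammingNorm_hexCoLoop_le i⟩
      fun c' hc' h => le_hammingNorm_of_cocycle hL hc' (i := i) ?_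
    exact (h i).trans_ne ((hpair i i).trans_ne (by simp))
  · have hx : ∀ i, (((B.x 0 + B.x 1 : cocycles (hexD₂ L))) : HexEdge L → ZMod 2) ⬝ᵥ hexLoop L i =
        1 := fun i => by
      change (hexCoLoop L 0 + hexCoLoop L 1) ⬝ᵥ hexLoop L i = 1
      rw [add_dotProduct, hpair, hpair]
      fin_cases i <;> rfl
    rw [B.cohomologyWeight_eq (n := 3 * m) ⟨P 0 + P 3, hP 0 3, fun i => ?_, hdn⟩
      fun c' hc' h => ?_]
    · rw [hmq]; push_cast; ring
    · refine Eq.trans ?_ (hx i).symm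
      fin_cases i
      · exact hd0
      · exact hd1
    · have := le_hammingNorm_of_diagonal_cocycle hL hc' (((h 0).trans (hx 0)).trans_ne one_ne_zero)
        (((h 1).trans (hx 1)).trans_ne one_ne_zero)
      omega
  · have hN : xOp (hexCoLoop L 0) ∈ pauliNormaliser (hexStabiliser L) :=
      mem_pauliNormaliser_surfaceStabiliser.2 ⟨hexCoLoop_mem_cocycles hL 0, zero_mem _⟩
    have hS : xOp (hexCoLoop L 0) ∉ hexStabiliser L := fun h =>
      zero_ne_one ((((mem_hexStabiliser_iff hL).1 h).2.2.1 0).symm.trans (hpair 0 0))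
    refine ⟨_, hN, hS, ?_⟩
    rw [Nat.cast_inj]
    refine le_antisymm ?_ (le_pauliWeight_of_notMem_hexStabiliser hL hN hS)
    rw [pauliWeight_xOp]
    exact hammingNorm_hexCoLoop_le 0
  · rintro _ ⟨p, hp, hpS, rfl⟩
    exact_mod_cast le_pauliWeight_of_notMem_hexStabiliser hL hp hpS
  · have hN : xOp (P 0 + P 3) ∈ pauliNormaliser (hexStabiliser L) :=
      mem_pauliNormaliser_surfaceStabiliser.2 ⟨hP 0 3, zero_mem _⟩
    have hM : xOp (P 0 + P 3) ∉ B.logicalIso.lift singleBitFlips := by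
      rintro ⟨a, ha, hr⟩
      obtain ⟨-, -, h1, -⟩ := (represents_hexLogicalIso hL).1 hr
      have h10 := hd0.symm.trans (h1 0)
      have h11 := hd1.symm.trans (h1 1)
      rcases ha with rfl | rfl | rfl
      · exact one_ne_zero h10
      · exact one_ne_zero h11
      · exact one_ne_zero h10
    refine ⟨_, hN, hM, ?_⟩
    have h1 := le_pauliWeight_of_notMem_lift hL hN hM
    have h2 : pauliWeight (xOp (P 0 + P 3)) = 3 * m := by
      rw [pauliWeight_xOp] at h1 ⊢
      omega
    rw [h2, hmq]
    push_cast
    ring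
  · rintro _ ⟨p, hp, hpM, rfl⟩
    have h1 : ((3 * L : ℕ) : ℚ) ≤ (2 * pauliWeight p : ℕ) := by
      exact_mod_cast le_pauliWeight_of_notMem_lift hL hp hpM
    push_cast at h1
    linarith
  · refine ⟨w, ⟨⟨B.logicalIso, hT⟩, ?_⟩, rfl⟩
    rintro w' ⟨A, hA⟩
    -- From `4 w' < 3 L < 4 w + 6`, the value `w' = w + 1` would force `3 L = 4 w + 5`, which is
    -- impossible for even `L`.
    have := lt_of_transmutingConditions hL hA
    omega
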